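/- Let $d\in\{2,3\}$, let $\Omega\subset\mathbb R^d$ be a bounded polyhedral domain (open, connected, equal to the interior of its closure, with $\overline\Omega$ a finite union of simplices), let $\nu>0$ and $\sigma>0$. There is a constant $C>0$, depending only on $\Omega,\nu,\sigma$ (in particular not on $h$), such that for every $\sigma$-regular mesh $\mathcal T_h$ of $\Omega$ (defined below) and all $p_B,q_h\in\mathcal V_h$, $$\bigl|(s_B-\tilde s_B)(p_B,\Pi_hq_h)\bigr|\le C\,h^{3/2}\,|p_B|_{H^1(\Omega)}\,|q_h|_* .$$ **Mesh and dual mesh.** $\mathcal T_h$ is a conforming simplicial triangulation of $\overline\Omega$, $h_\triangle$ is the diameter of $\triangle\in\mathcal T_h$, $h=\max_\triangle h_\triangle$, and $\mathcal V_h$ is the space of continuous functions on $\overline\Omega$ that are affine on each $\triangle$. For a vertex $\mathbf p_i$ of $\mathcal T_h$, $B_i$ is its closed Voronoi cell with respect to all vertices. The box mesh is $\mathcal B_h=\{B_i:\mathbf p_i\in\Omega\}$ (boxes of the vertices not on $\partial\Omega$). Put $F_{ij}=B_i\cap B_j$; it is called a face if its $(d-1)$-dimensional area $|F_{ij}|$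 is positive. For $B_i\in\mathcal B_h$ let $G_i$ be the set of all vertices $\mathbf p_j\ne\mathbf p_i$ (boundary vertices included) for which $F_{ij}$ is a face, and let $\mathcal F_h$ be the set of faces between two boxes of $\mathcal B_h$. Let $d_{ij}=|\mathbf p_i-\mathbf p_j|$, let $\mathbf n_{ij}=(\mathbf p_j-\mathbf p_i)/d_{ij}$ be the unit normal of $F_{ij}$ pointing out of $B_i$, and let $w_{ij}$ be the distance of $\mathbf p_j$ from the plane of $F_{ij}$ divided by $d_{ij}$. **Regularity.** The mesh is $\sigma$-regular if: (a) it is Delaunay: no vertex lies inside the circumsphere of an element; (b) each $\triangle$ contains a ball of radius $h_\triangle/\sigma$; (c) $h\le\sigma h_\triangle$ for all $\triangle$; (d) for each $B_i\in\mathcal B_h$, $\sigma^{-1}h_\triangle^d\le|B_i|\le\sigma h_\triangle^d$ for some $\triangle$ meeting $B_i$; (e) for all $B_i\in\mathcal B_h$ and each face $F_{ij}\in\mathcal F_h$ of $B_i$, $\sigma^{-1}h_\triangle\le d_{ij}\le\sigma h_\triangle$ and $\sigma^{-1}h_\triangle^{d-1}\le|F_{ij}|\le\sigma h_\triangle^{d-1}$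 for some $\triangle$ meeting $B_i$; (f) for $B_i\in\mathcal B_h$ and $\mathbf p_j\in G_i$, $F_{ij}$ is contained in the union of the elements having both $\mathbf p_i$ and $\mathbf p_j$ as vertices. **Operators.** $\mathcal W_h$ is the space of functions that are constant on each box of $\mathcal B_h$; $\Pi_h:\mathcal V_h\to\mathcal W_h$ is given by $(\Pi_hq)_i=q(\mathbf p_i)$; $[\![z]\!]_{ij}=z_i-z_j$; $D_i=\sum_{\mathbf p_j\in G_i}\nu|F_{ij}|/d_{ij}$; and the Gauss–Green gradient is given by $$|B_i|\nabla_{h,i}q=\sum_{\mathbf p_j\in G_i}|F_{ij}|\,\mathbf n_{ij}\bigl(w_{ij}q(\mathbf p_i)+(1-w_{ij})q(\mathbf p_j)\bigr).$$ For $q\in\mathcal V_h$ and $z\in\mathcal W_h$, with $\kappa_{ij}=w_{ij}|B_i|D_i^{-1}+(1-w_{ij})|B_j|D_j^{-1}$, $$s_B(q,z)=\sum_{F_{ij}\in\mathcal F_h}\int_{F_{ij}}\Bigl(w_{ij}D_i^{-1}\!\int_{B_i}\!\nabla q\,dx+(1-w_{ij})D_j^{-1}\!\int_{B_j}\!\nabla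 q\,dx\Bigr)\cdot\mathbf n_{ij}[\![z]\!]_{ij}\,ds-\sum_{F_{ij}\in\mathcal F_h}\int_{F_{ij}}\kappa_{ij}\frac{\partial q}{\partial\mathbf n_{ij}}[\![z]\!]_{ij}\,ds,$$ $$\tilde s_B(q,z)=\sum_{F_{ij}\in\mathcal F_h}\int_{F_{ij}}\Bigl(w_{ij}D_i^{-1}|B_i|\nabla_{h,i}q+(1-w_{ij})D_j^{-1}|B_j|\nabla_{h,j}q\Bigr)\cdot\mathbf n_{ij}[\![z]\!]_{ij}\,ds-\sum_{F_{ij}\in\mathcal F_h}\int_{F_{ij}}\kappa_{ij}\frac{q(\mathbf p_j)-q(\mathbf p_i)}{d_{ij}}[\![z]\!]_{ij}\,ds .$$ **Seminorms.** $|p|_{H^1(\Omega)}=\bigl(\int_\Omega|\nabla p|^2dx\bigr)^{1/2}$ and $|q|_*=\Bigl(\sum_{F_{ij}\in\mathcal F_h}d_{ij}\int_{F_{ij}}\bigl|\frac{\partial q}{\partial\mathbf n_{ij}}\bigr|^2ds\Bigr)^{1/2}$. -/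

import Mathlib

open MeasureTheory
open scoped Classical

noncomputable section

namespace RhieChow

/-- The Euclidean space `ℝ^d`. -/
abbrev Pt (d : ℕ) : Type := EuclideanSpace ℝ (Fin d)

/-- A bounded polyhedral domain: nonempty, open, connected, bounded, equal to the interior of its
closure, and with a closure that is a finite union of simplices fitting together. -/
structure IsPolyhedralDomain {d : ℕ} (Ω : Set (Pt d)) : Prop where
  isOpen : IsOpen Ω
  isConnected : IsConnected Ω
  isBounded : Bornology.IsBounded Ω
  interior_closure : interior (closure Ω) = Ω
  polyhedral : ∃ K : Geometry.SimplicialComplex ℝ (Pt d), K.faces.Finite ∧ K.space = closure Ω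

/-- A conforming triangulation `𝒯_h` of `Ω`: a finite, pure `d`-dimensional simplicial complex
whose underlying space is the closure of `Ω`. -/
structure Triangulation {d : ℕ} (Ω : Set (Pt d)) where
  /-- the simplices of all dimensions, given by their vertex sets -/
  complex : Geometry.SimplicialComplex ℝ (Pt d)
  finite_faces : complex.faces.Finite
  pure_dim : ∀ s ∈ complex.faces, ∃ t ∈ complex.faces, s ⊆ t ∧ t.card = d + 1
  space_eq : complex.space = closure Ω

namespace Triangulation

variable {d : ℕ} {Ω : Set (Pt d)} (T : Triangulation Ω)

/-- The elements `△` of the mesh (each given by its `d + 1` vertices). -/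
def elements : Finset (Finset (Pt d)) :=
  T.finite_faces.toFinset.filter (fun t => t.card = d + 1)

/-- The closed simplex spanned by a finite set of vertices. -/
def cell (t : Finset (Pt d)) : Set (Pt d) := convexHull ℝ (t : Set (Pt d))

/-- The set of all mesh vertices. -/
def vertices : Finset (Pt d) := T.elements.biUnion id

/-- The vertices in the open set `Ω`, i.e. those not on the boundary. They index the boxes. -/
def interiorVertices : Finset (Pt d) := T.vertices.filter (fun v => v ∈ Ω)

/-- The mesh size `h`, the maximum of the diameters `h_△`. -/
def meshSize : ℝ := ⨆ t : T.elements, Metric.diam (cell (t : Finset (Pt d)))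

/-- The space `𝒱_h` of continuous functions on the closure of `Ω` that are affine on every element.
(Values outside the closure of `Ω` play no role.) -/
def IsP1 (q : Pt d → ℝ) : Prop :=
  ContinuousOn q (closure Ω) ∧
    ∀ t ∈ T.elements, ∃ g : Pt d →ᵃ[ℝ] ℝ, Set.EqOn q g (cell t)

/-- The closed Voronoi box `B_v` of the vertex `v`. -/
def box (v : Pt d) : Set (Pt d) := {x | ∀ w ∈ T.vertices, dist x v ≤ dist x w}

/-- The common face `F_{vw}` of two boxes. -/
def face (v w : Pt d) : Set (Pt d) := T.box v ∩ T.box w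

/-- The surface (`(d-1)`-dimensional Euclidean) measure `ds`. -/
def surf : Measure (Pt d) := Measure.euclideanHausdorffMeasure (d - 1)

/-- The area `|F_{vw}|`. -/
def faceArea (v w : Pt d) : ℝ := (surf (d := d)).real (T.face v w)

/-- The volume `|B_v|`. -/
def boxVol (v : Pt d) : ℝ := volume.real (T.box v)

/-- The vertices whose boxes share a genuine (positive area) face with the box of `v`. -/
def neighbours (v : Pt d) : Finset (Pt d) :=
  T.vertices.filter (fun w => w ≠ v ∧ 0 < T.faceArea v w)

/-- The unit normal `n_{vw}` of `F_{vw}` pointing out of `B_v`. -/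
def normal (v w : Pt d) : Pt d := (dist v w)⁻¹ • (w - v)

/-- The interpolation weight `w_{vw}`: the distance of `w` from (the plane of) the face `F_{vw}`
divided by `d_{vw} = dist v w`. -/
def weight (v w : Pt d) : ℝ :=
  Metric.infDist w (affineSpan ℝ (T.face v w) : Set (Pt d)) / dist v w

/-- The diagonal coefficient `D_v` of the velocity matrix with viscosity `ν`. -/
def diagCoeff (ν : ℝ) (v : Pt d) : ℝ :=
  ∑ w ∈ T.neighbours v, ν * T.faceArea v w / dist v w

/-- The Gauss-Green gradient of `q` on the box of `v`; the sum is over all faces of that box. -/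
def gaussGreen (q : Pt d → ℝ) (v : Pt d) : Pt d :=
  (T.boxVol v)⁻¹ • ∑ w ∈ T.neighbours v,
    (T.faceArea v w * (T.weight v w * q v + (1 - T.weight v w) * q w)) • normal v w

/-- The normal derivative `∂q/∂n_{vw}` at `x`. -/
def normalDeriv (q : Pt d → ℝ) (v w x : Pt d) : ℝ := fderiv ℝ q x (normal v w)

/-- The space `𝒲_h` of box-wise constant functions, given by their values on the boxes. -/
abbrev BoxFun : Type := T.interiorVertices → ℝ

/-- The lumping map `Π_h`. -/
def lump (q : Pt d → ℝ) : T.BoxFun := fun v => q v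

/-- The jump `⟦z⟧_{ij} = z_i - z_j`. -/
def jump (z : T.BoxFun) (i j : T.interiorVertices) : ℝ := z i - z j

/-- The sum over the set `ℱ_h` of faces `F_{ij}` between two boxes. Every face is met twice, as
`(i, j)` and as `(j, i)`, whence the factor `1/2`; all summands used below are symmetric. -/
def faceSum (φ : T.interiorVertices → T.interiorVertices → ℝ) : ℝ :=
  (1 / 2) * ∑ i : T.interiorVertices,
    ∑ j ∈ Finset.univ.filter
      (fun j : T.interiorVertices => (j : Pt d) ∈ T.neighbours (i : Pt d)), φ i j

/-- First part of the auxiliary Rhie-Chow operator (exact integrals of the gradient on boxes). -/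
def sAux1 (ν : ℝ) (q : Pt d → ℝ) (z : T.BoxFun) : ℝ :=
  T.faceSum fun i j => ∫ _x in T.face i j,
    inner ℝ
      ((T.weight i j * (T.diagCoeff ν i)⁻¹) • (∫ y in T.box i, gradient q y)
        + ((1 - T.weight i j) * (T.diagCoeff ν j)⁻¹) • (∫ y in T.box j, gradient q y))
      (normal (i : Pt d) j) * T.jump z i j ∂surf

/-- Second part of the auxiliary Rhie-Chow operator (exact normal derivative). -/
def sAux2 (ν : ℝ) (q : Pt d → ℝ) (z : T.BoxFun) : ℝ :=
  T.faceSum fun i j => ∫ x in T.face i j,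
    (T.weight i j * T.boxVol i * (T.diagCoeff ν i)⁻¹
        + (1 - T.weight i j) * T.boxVol j * (T.diagCoeff ν j)⁻¹)
      * normalDeriv q (i : Pt d) j x * T.jump z i j ∂surf

/-- The auxiliary Rhie-Chow operator `s_B`. -/
def sAux (ν : ℝ) (q : Pt d → ℝ) (z : T.BoxFun) : ℝ := T.sAux1 ν q z - T.sAux2 ν q z

/-- First part of the discrete Rhie-Chow operator (Gauss-Green gradients). -/
def sDisc1 (ν : ℝ) (q : Pt d → ℝ) (z : T.BoxFun) : ℝ :=
  T.faceSum fun i j => ∫ _x in T.face i j,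
    inner ℝ
      ((T.weight i j * (T.diagCoeff ν i)⁻¹ * T.boxVol i) • T.gaussGreen q i
        + ((1 - T.weight i j) * (T.diagCoeff ν j)⁻¹ * T.boxVol j) • T.gaussGreen q j)
      (normal (i : Pt d) j) * T.jump z i j ∂surf

/-- Second part of the discrete Rhie-Chow operator (difference quotient). -/
def sDisc2 (ν : ℝ) (q : Pt d → ℝ) (z : T.BoxFun) : ℝ :=
  T.faceSum fun i j => ∫ _x in T.face i j,
    (T.weight i j * T.boxVol i * (T.diagCoeff ν i)⁻¹
        + (1 - T.weight i j) * T.boxVol j * (T.diagCoeff ν j)⁻¹)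
      * ((T.lump q j - T.lump q i) / dist (i : Pt d) j) * T.jump z i j ∂surf

/-- The discrete Rhie-Chow operator `s̃_B`. -/
def sDisc (ν : ℝ) (q : Pt d → ℝ) (z : T.BoxFun) : ℝ := T.sDisc1 ν q z - T.sDisc2 ν q z

/-- The seminorm `|q|_*`. -/
def starNorm (q : Pt d → ℝ) : ℝ :=
  Real.sqrt (T.faceSum fun i j =>
    dist (i : Pt d) j * ∫ x in T.face i j, |normalDeriv q (i : Pt d) j x| ^ 2 ∂surf)

/-- The standing assumptions on the mesh, with all constants collected in one number `σ`. -/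
structure IsRegular (σ : ℝ) : Prop where
  /-- Delaunay: no vertex lies inside the circumsphere of an element -/
  delaunay : ∀ t ∈ T.elements, ∀ (c : Pt d) (r : ℝ), (∀ v ∈ t, dist v c = r) →
    ∀ w ∈ T.vertices, r ≤ dist w c
  /-- shape regularity: every element contains a ball of radius `h_△ / σ` -/
  shape : ∀ t ∈ T.elements, ∃ c : Pt d,
    Metric.closedBall c (Metric.diam (cell t) / σ) ⊆ cell t
  /-- quasi-uniformity -/
  quasiUniform : ∀ t ∈ T.elements, T.meshSize ≤ σ * Metric.diam (cell t)
  /-- `|B_i| ≃ h_△^d` for some element meeting the box -/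
  boxVol_equiv : ∀ i ∈ T.interiorVertices, ∃ t ∈ T.elements, (cell t ∩ T.box i).Nonempty ∧
    σ⁻¹ * Metric.diam (cell t) ^ d ≤ T.boxVol i ∧ T.boxVol i ≤ σ * Metric.diam (cell t) ^ d
  /-- `d_{ij} ≃ h_△` and `|F_{ij}| ≃ h_△^{d-1}` for some element meeting the box -/
  face_equiv : ∀ i ∈ T.interiorVertices, ∀ j ∈ T.interiorVertices, j ∈ T.neighbours i →
    ∃ t ∈ T.elements, (cell t ∩ T.box i).Nonempty ∧
      σ⁻¹ * Metric.diam (cell t) ≤ dist i j ∧ dist i j ≤ σ * Metric.diam (cell t) ∧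
      σ⁻¹ * Metric.diam (cell t) ^ (d - 1) ≤ T.faceArea i j ∧
      T.faceArea i j ≤ σ * Metric.diam (cell t) ^ (d - 1)
  /-- every face of a box lies in the union of the elements sharing the corresponding edge, so
  that normal derivatives of functions of `𝒱_h` make sense on it -/
  face_subset : ∀ i ∈ T.interiorVertices, ∀ j ∈ T.neighbours i, ∀ x ∈ T.face i j,
    ∃ t ∈ T.elements, i ∈ t ∧ j ∈ t ∧ x ∈ cell t

end Triangulation

/-- The seminorm `|q|_{H^1(Ω)}` of a piecewise smooth continuous function. -/
def h1Seminorm {d : ℕ} (Ω : Set (Pt d)) (q : Pt d → ℝ) : ℝ :=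
  Real.sqrt (∫ x in Ω, ‖gradient q x‖ ^ 2)

end RhieChow

end

/-! Both terms being compared are small on their own, so no consistency of the Gauss–Green gradient
is needed. A face `F_ij` lies in the elements that have the edge `ij`, and there a function of `𝒱_h`
is affine; its normal derivative is therefore the difference quotient almost everywhere on the face,
and the second parts of the two operators cancel (`sAux2_eq_sDisc2`). What remains is, on each box,
`D_i⁻¹` times the defect `∫_{B_i} ∇p - |B_i| ∇_{h,i} p`.

The defect is controlled by the geometry of a Voronoi box. Cutting the box into pyramids over its
faces, with an apex `x₀` strictly closer to `v` than to every other vertex, gives `d |B| = ∑ (height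
from x₀) |F|` (`boxVol_eq_sum`). Taking `x₀ = v` yields `∑ d_ij |F_ij| = 2 d |B_i|`; since the left
side does not depend on `x₀`, Minkowski's relation `∑ |F_ij| n_ij = 0` follows. Minkowski's relation
lets `p(v)` be subtracted from every term of the Gauss–Green sum, so the defect is at most a
constant times `|B_i|` times the element gradients around `v`. The first identity also gives `2 d ν
|B_i| ≤ h² D_i`, so `D_i⁻¹` times the defect is of order `h²` times those gradients
(`norm_inv_diagCoeff_smul_le`).

Finally `|F| = √(d_ij |F|) √(|F| / d_ij)` and Cauchy–Schwarz over the faces: the second factor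
produces exactly `|q|_*`, the first is summed back to `|p|_{H¹}` because box volumes are bounded by
element volumes. The result has order `h²`, and the surplus `h^{1/2}` is bounded through the
diameter of `Ω`. -/

namespace RhieChow

/-! ### Volume of a pyramid in Euclidean space. -/

section Cone

variable {d : ℕ}

/-- A hyperplane is a null set. -/
theorem volume_hyperplane_eq_zero {m : Pt d} (hm : m ≠ 0) (x₀ : Pt d) :
    volume {x : Pt d | inner ℝ m (x - x₀) = 0} = 0 := by
  have h := Measure.addHaar_affineSubspace (volume : Measure (Pt d))
    (AffineSubspace.mk' x₀ (Submodule.span ℝ {m})ᗮ) (by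
      intro h
      have h1 : m + x₀ ∈ AffineSubspace.mk' x₀ (Submodule.span ℝ {m})ᗮ := by
        rw [h]; trivial
      rw [AffineSubspace.mem_mk', vsub_eq_sub, add_sub_cancel_right,
        Submodule.mem_orthogonal_singleton_iff_inner_right, inner_self_eq_zero] at h1
      exact hm h1)
  refine measure_mono_null (fun x hx => ?_) h
  simpa [AffineSubspace.mem_mk', Submodule.mem_orthogonal_singleton_iff_inner_right] using hx

/-- The pyramid with apex `x₀` (apex removed) over a base in the plane `⟪a, x - x₀⟫ = c`. -/
def pyramid (x₀ a : Pt d) (c : ℝ) (F : Set (Pt d)) : Set (Pt d) :=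
  {x | 0 < inner ℝ a (x - x₀) ∧ inner ℝ a (x - x₀) ≤ c ∧
    x₀ + (c / inner ℝ a (x - x₀)) • (x - x₀) ∈ F}

theorem measurableSet_pyramid (x₀ a : Pt d) (c : ℝ) {F : Set (Pt d)} (hF : MeasurableSet F) :
    MeasurableSet (pyramid x₀ a c F) := by
  have hm : Measurable fun x : Pt d => inner ℝ a (x - x₀) := by fun_prop
  refine (measurableSet_lt measurable_const hm).inter
    ((measurableSet_le hm measurable_const).inter ?_)
  exact hF.preimage (by fun_prop)

theorem pyramid_smul (x₀ a : Pt d) (c : ℝ) (F : Set (Pt d)) {r : ℝ} (hr : 0 < r) :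
    pyramid x₀ (r • a) (r * c) F = pyramid x₀ a c F := by
  ext x
  simp only [pyramid, Set.mem_ofPred_eq, real_inner_smul_left]
  rw [mul_div_mul_left _ _ hr.ne', mul_le_mul_iff_right₀ hr, mul_pos_iff_of_pos_left hr]

/-- Fubini along the axis: the slice at height `τ` is the base shrunk by `τ / c`, with area `(τ /
c)^(d-1)` times that of the base, and integrating over `(0, c]` gives `c / d`. -/
theorem volume_pyramid_of_norm_eq_one (hd : 1 ≤ d) {x₀ n : Pt d} (hn : ‖n‖ = 1) {c : ℝ}
    (hc : 0 < c) {F : Set (Pt d)} (hF : MeasurableSet F)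
    (hFc : ∀ x ∈ F, inner ℝ n (x - x₀) = c) :
    volume (pyramid x₀ n c F) = ENNReal.ofReal (c / d) * Triangulation.surf F := by
  have hn0 : n ≠ 0 := by rintro rfl; simp at hn
  set L := AffineSubspace.mk' x₀ (Submodule.span ℝ {n}) with hL
  have hx₀ : x₀ ∈ L := AffineSubspace.self_mem_mk' _ _
  have : Nonempty L := ⟨⟨x₀, hx₀⟩⟩
  have hdir : L.direction = Submodule.span ℝ {n} := AffineSubspace.direction_mk' _ _
  have hfr1 : Module.finrank ℝ L.direction = 1 := by rw [hdir]; exact finrank_span_singleton hn0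
  have hfr2 : Module.finrank ℝ L.directionᗮ = d - 1 := by
    have := Submodule.finrank_add_finrank_orthogonal L.direction
    rw [hfr1, finrank_euclideanSpace_fin] at this
    omega
  have key := AffineSubspace.euclideanHausdorffMeasure_eq_lintegral (P := Pt d) L
    (measurableSet_pyramid x₀ n c hF)
  rw [hfr1, hfr2, InnerProductSpace.euclideanHausdorffMeasure_eq_volume] at key
  rw [key]
  -- Arc-length parametrization of the axis, turning the integral over `L` into one over `ℝ`.
  let e : ℝ ≃ᵢ L := IsometryEquiv.mk'
    (fun τ => ⟨x₀ + τ • n, by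
      rw [hL, AffineSubspace.mem_mk', vsub_eq_sub, add_sub_cancel_left]
      exact Submodule.smul_mem _ _ (Submodule.mem_span_singleton_self n)⟩)
    (fun x => inner ℝ n ((x : Pt d) - x₀))
    (by
      rintro ⟨x, hx⟩
      rw [hL, AffineSubspace.mem_mk', vsub_eq_sub, Submodule.mem_span_singleton] at hx
      obtain ⟨τ, hτ⟩ := hx
      ext1
      simp only
      rw [← hτ, real_inner_smul_right, real_inner_self_eq_norm_sq, hn]
      rw [one_pow, mul_one, hτ, add_sub_cancel])
    (by
      refine Isometry.of_dist_eq fun s t => ?_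
      rw [Subtype.dist_eq, dist_add_left, dist_eq_norm, ← sub_smul, norm_smul, hn, mul_one]
      rfl)
  have he := e.measurePreserving_euclideanHausdorffMeasure 1
  have h1 : (Measure.euclideanHausdorffMeasure 1 : Measure ℝ) = volume := by
    have := InnerProductSpace.euclideanHausdorffMeasure_eq_volume (V := ℝ)
    rwa [Module.finrank_self] at this
  rw [h1] at he
  rw [← he.lintegral_comp_emb e.toHomeomorph.measurableEmbedding]
  have hslice : ∀ τ : ℝ, Measure.euclideanHausdorffMeasure (d - 1)
      (pyramid x₀ n c F ∩ (AffineSubspace.mk' ((e τ : L) : Pt d) L.directionᗮ : Set (Pt d)))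
      = (Set.Ioc 0 c).indicator
          (fun τ => ENNReal.ofReal ((τ / c) ^ (d - 1)) * Triangulation.surf F) τ := by
    intro τ
    have hmem : ∀ x : Pt d, x ∈ (AffineSubspace.mk' ((e τ : L) : Pt d) L.directionᗮ : Set (Pt d)) ↔
        inner ℝ n (x - x₀) = τ := by
      intro x
      have : ((e τ : L) : Pt d) = x₀ + τ • n := rfl
      rw [SetLike.mem_coe, AffineSubspace.mem_mk', vsub_eq_sub, hdir,
        Submodule.mem_orthogonal_singleton_iff_inner_right, this, ← sub_sub, inner_sub_right,
        real_inner_smul_right, real_inner_self_eq_norm_sq, hn, one_pow, mul_one, sub_eq_zero]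
    by_cases hτ : τ ∈ Set.Ioc 0 c
    · rw [Set.indicator_of_mem hτ]
      have hτ0 : 0 < τ := hτ.1
      have hset : pyramid x₀ n c F ∩
          (AffineSubspace.mk' ((e τ : L) : Pt d) L.directionᗮ : Set (Pt d))
          = AffineMap.homothety x₀ (c / τ) ⁻¹' F := by
        ext x
        rw [Set.mem_inter_iff, hmem, Set.mem_preimage, AffineMap.homothety_apply, vsub_eq_sub,
          vadd_eq_add, add_comm]
        constructor
        · rintro ⟨⟨-, -, h⟩, h'⟩
          rwa [h'] at h
        · intro h
          have h2 := hFc _ h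
          rw [add_sub_cancel_left, real_inner_smul_right] at h2
          have h3 : inner ℝ n (x - x₀) = τ := by
            field_simp at h2
            linarith
          refine ⟨⟨?_, ?_, ?_⟩, h3⟩
          · rw [h3]; exact hτ0
          · rw [h3]; exact hτ.2
          · rw [h3]; exact h
      rw [hset, euclideanHausdorffMeasure_homothety_preimage _ _ (by positivity)]
      rw [Triangulation.surf, ENNReal.smul_def, smul_eq_mul]
      congr 1
      rw [ENNReal.ofReal, ENNReal.coe_inj]
      ext
      rw [Real.coe_toNNReal _ (by positivity)]
      simp [abs_of_pos hc, abs_of_pos hτ0]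
    · rw [Set.indicator_of_notMem hτ]
      convert measure_empty (μ := Measure.euclideanHausdorffMeasure (d - 1))
      rw [Set.eq_empty_iff_forall_notMem]
      rintro x ⟨⟨h1, h2, -⟩, h3⟩
      rw [hmem] at h3
      exact hτ ⟨h3 ▸ h1, h3 ▸ h2⟩
  simp_rw [hslice]
  rw [lintegral_indicator measurableSet_Ioc, lintegral_mul_const _ (by fun_prop)]
  congr 1
  rw [← ofReal_integral_eq_lintegral_ofReal]
  · congr 1
    rw [← intervalIntegral.integral_of_le hc.le]
    simp_rw [div_pow]
    rw [intervalIntegral.integral_div, integral_pow]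
    have : ((d - 1 : ℕ) : ℝ) + 1 = d := by exact_mod_cast Nat.sub_add_cancel hd
    rw [this, Nat.sub_add_cancel hd, zero_pow (by omega), sub_zero]
    obtain ⟨k, rfl⟩ : ∃ k, d = k + 1 := ⟨d - 1, by omega⟩
    simp only [Nat.add_sub_cancel]
    field_simp
    exact pow_succ c k
  · exact (Continuous.integrableOn_Ioc (by fun_prop))
  · filter_upwards [self_mem_ae_restrict measurableSet_Ioc] with τ hτ
    have := hτ.1
    positivity

/-- The volume of a pyramid. -/
theorem volume_pyramid (hd : 1 ≤ d) {x₀ a : Pt d} (ha : a ≠ 0) {c : ℝ}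
    (hc : 0 < c) {F : Set (Pt d)} (hF : MeasurableSet F)
    (hFc : ∀ x ∈ F, inner ℝ a (x - x₀) = c) :
    volume (pyramid x₀ a c F) = ENNReal.ofReal (c / ‖a‖ / d) * Triangulation.surf F := by
  have ha' : 0 < ‖a‖⁻¹ := by positivity
  rw [← pyramid_smul x₀ a c F ha',
    volume_pyramid_of_norm_eq_one hd (by simp [norm_smul, ha]) (by positivity) hF
      (fun x hx => by rw [real_inner_smul_left, hFc x hx]), div_eq_inv_mul c]

end Cone

end RhieChow

/-! ### Voronoi boxes: decomposition into face pyramids and Minkowski's relation. -/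

noncomputable section

namespace RhieChow

namespace Triangulation

variable {d : ℕ} {Ω : Set (Pt d)} (T : Triangulation Ω)

/-- Half the difference of the squared distances of `x` from `w` and from `v`, an affine function
of `x`. -/
def gap (v w x : Pt d) : ℝ := ‖w - v‖ ^ 2 / 2 - inner ℝ (w - v) (x - v)

theorem gap_eq (v w x : Pt d) : gap v w x = (dist x w ^ 2 - dist x v ^ 2) / 2 := by
  have h : x - w = (x - v) - (w - v) := by abel
  rw [gap, dist_eq_norm, dist_eq_norm, h, norm_sub_sq_real (x - v) (w - v),
    real_inner_comm (x - v)]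
  ring

theorem gap_sub_gap (v w x y : Pt d) : gap v w x - gap v w y = inner ℝ (w - v) (y - x) := by
  have h : y - x = (y - v) - (x - v) := by abel
  rw [gap, gap, h, inner_sub_right (w - v) (y - v)]
  ring

theorem gap_nonneg_iff (v w x : Pt d) : 0 ≤ gap v w x ↔ dist x v ≤ dist x w := by
  rw [gap_eq, ← sq_le_sq₀ dist_nonneg dist_nonneg]
  constructor <;> intro h <;> linarith

theorem gap_lineMap (v w x₀ x : Pt d) (s : ℝ) :
    gap v w (x₀ + s • (x - x₀)) = gap v w x₀ - s * (gap v w x₀ - gap v w x) := by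
  have h := gap_sub_gap v w x₀ (x₀ + s • (x - x₀))
  rw [add_sub_cancel_left, real_inner_smul_right, ← gap_sub_gap v w x₀ x] at h
  linarith

variable {T}

theorem mem_box_iff {v x : Pt d} : x ∈ T.box v ↔ ∀ w ∈ T.vertices, 0 ≤ gap v w x := by
  simp only [gap_nonneg_iff]; rfl

theorem mem_face_iff {v w : Pt d} (hv : v ∈ T.vertices) (hw : w ∈ T.vertices) {x : Pt d} :
    x ∈ T.face v w ↔ x ∈ T.box v ∧ gap v w x = 0 := by
  constructor
  · rintro ⟨h1, h2⟩
    have : dist x v = dist x w := le_antisymm (h1 w hw) (h2 v hv)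
    exact ⟨h1, by rw [gap_eq, this]; ring⟩
  · rintro ⟨h1, h2⟩
    refine ⟨h1, fun u hu => ?_⟩
    have h3 : dist x w ≤ dist x v := by
      rw [gap_eq] at h2
      rw [← sq_le_sq₀ dist_nonneg dist_nonneg]
      linarith
    exact h3.trans (h1 u hu)

theorem face_comm (v w : Pt d) : T.face v w = T.face w v := Set.inter_comm _ _

theorem faceArea_comm (v w : Pt d) : T.faceArea v w = T.faceArea w v := by
  rw [faceArea, face_comm, faceArea]

theorem isClosed_box (v : Pt d) : IsClosed (T.box v) := by
  have : T.box v = ⋂ w ∈ T.vertices, {x | dist x v ≤ dist x w} := by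
    ext x; simp [box]
  rw [this]
  exact isClosed_biInter fun w _ => isClosed_le (by fun_prop) (by fun_prop)

theorem isClosed_face (v w : Pt d) : IsClosed (T.face v w) :=
  (isClosed_box v).inter (isClosed_box w)

theorem mem_elements {t : Finset (Pt d)} :
    t ∈ T.elements ↔ t ∈ T.complex.faces ∧ t.card = d + 1 := by
  simp [elements]

theorem mem_vertices_of_mem {t : Finset (Pt d)} (ht : t ∈ T.elements) {v : Pt d} (hv : v ∈ t) :
    v ∈ T.vertices := Finset.mem_biUnion.2 ⟨t, ht, hv⟩

theorem closure_eq_iUnion : closure Ω = ⋃ t ∈ T.elements, cell t := by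
  rw [← T.space_eq]
  ext x
  simp only [Geometry.SimplicialComplex.mem_space_iff, Set.mem_iUnion, exists_prop, cell]
  constructor
  · rintro ⟨s, hs, hx⟩
    obtain ⟨t, ht, hst, hc⟩ := T.pure_dim s hs
    exact ⟨t, mem_elements.2 ⟨ht, hc⟩, convexHull_mono (by exact_mod_cast hst) hx⟩
  · rintro ⟨t, ht, hx⟩
    exact ⟨t, (mem_elements.1 ht).1, hx⟩

theorem closure_subset_convexHull : closure Ω ⊆ convexHull ℝ (T.vertices : Set (Pt d)) := by
  rw [T.closure_eq_iUnion]
  refine Set.iUnion₂_subset fun t ht => convexHull_mono fun v hv => ?_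
  exact mem_vertices_of_mem ht hv

theorem mem_interiorVertices {v : Pt d} :
    v ∈ T.interiorVertices ↔ v ∈ T.vertices ∧ v ∈ Ω := by simp [interiorVertices]

theorem mem_neighbours {v w : Pt d} :
    w ∈ T.neighbours v ↔ w ∈ T.vertices ∧ w ≠ v ∧ 0 < T.faceArea v w := by simp [neighbours]

/-- In every direction from a vertex in the interior there is a vertex ahead. -/
theorem exists_vertex_inner_ge (hΩ : IsOpen Ω) {v : Pt d} (hv : v ∈ Ω) :
    ∃ ε > 0, ∀ y : Pt d, ∃ w ∈ T.vertices, ε * ‖y‖ ≤ inner ℝ (w - v) y := by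
  obtain ⟨ε, hε, hball⟩ := Metric.nhds_basis_closedBall.mem_iff.1 (hΩ.mem_nhds hv)
  refine ⟨ε, hε, fun y => ?_⟩
  by_contra! hcon
  have hsub : (T.vertices : Set (Pt d)) ⊆ {x | inner ℝ y x < inner ℝ y v + ε * ‖y‖} := by
    intro w hw
    have := hcon w hw
    rw [real_inner_comm, inner_sub_right] at this
    simp only [Set.mem_ofPred_eq]
    linarith
  have hconv : Convex ℝ {x : Pt d | inner ℝ y x < inner ℝ y v + ε * ‖y‖} :=
    convex_halfSpace_lt (f := fun x => inner ℝ y x)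
      ⟨fun a b => inner_add_right _ _ _, fun c a => by simp [real_inner_smul_right]⟩ _
  -- If all vertices were behind this point in direction `y`, so would be their convex hull, which
  -- contains it. For `y = 0` the division convention makes the point `v` itself.
  have hmem : v + (ε / ‖y‖) • y ∈ closure Ω := by
    refine subset_closure (hball ?_)
    rw [Metric.mem_closedBall, dist_eq_norm, add_sub_cancel_left, norm_smul, norm_div, norm_norm,
      Real.norm_of_nonneg hε.le]
    rcases eq_or_ne ‖y‖ 0 with h | h
    · rw [h]; simp [hε.le]
    · rw [div_mul_cancel₀ _ h]
  have := convexHull_min hsub hconv (T.closure_subset_convexHull hmem)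
  simp only [Set.mem_ofPred_eq, inner_add_right, real_inner_smul_right,
    real_inner_self_eq_norm_sq] at this
  rcases eq_or_ne ‖y‖ 0 with h | h
  · rw [h] at this; simp at this
  · field_simp at this
    exact lt_irrefl _ this

/-- The box of an interior vertex is bounded. -/
theorem isBounded_box (hΩ : IsOpen Ω) {v : Pt d} (hv : v ∈ Ω) :
    Bornology.IsBounded (T.box v) := by
  obtain ⟨ε, hε, h⟩ := T.exists_vertex_inner_ge hΩ hv
  have hb := T.vertices.finite_toSet.isBounded.subset_closedBall v
  obtain ⟨R, hR⟩ := hb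
  -- The radius: a nonnegative gap says `⟪w - v, x - v⟫ ≤ ‖w - v‖² / 2 ≤ R² / 2`, and the vertex `w`
  -- ahead of `x` makes the left side at least `ε ‖x - v‖`.
  refine Metric.isBounded_closedBall.subset
    (fun x hx => ?_ : T.box v ⊆ Metric.closedBall v (R ^ 2 / 2 / ε))
  obtain ⟨w, hw, hwx⟩ := h (x - v)
  have h1 := mem_box_iff.1 hx w hw
  rw [gap] at h1
  have h2 := hR hw
  rw [Metric.mem_closedBall, dist_eq_norm] at h2 ⊢
  rw [le_div_iff₀ hε]
  have : ‖w - v‖ ^ 2 ≤ R ^ 2 := by gcongr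
  linarith

theorem volume_box_lt_top (hΩ : IsOpen Ω) {v : Pt d} (hv : v ∈ Ω) : volume (T.box v) < ⊤ :=
  (isBounded_box hΩ hv).measure_lt_top

/-- The part of the box of `v` seen from `x₀` through the face shared with `w`. -/
def facePyramid (T : Triangulation Ω) (v w x₀ : Pt d) : Set (Pt d) :=
  pyramid x₀ (w - v) (gap v w x₀) (T.face v w)

theorem inner_sub_eq_gap {v w x₀ x : Pt d} (hv : v ∈ T.vertices) (hw : w ∈ T.vertices)
    (hx : x ∈ T.face v w) : inner ℝ (w - v) (x - x₀) = gap v w x₀ := by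
  rw [← gap_sub_gap, ((mem_face_iff hv hw).1 hx).2, sub_zero]

theorem volume_facePyramid (hd : 1 ≤ d) {v w x₀ : Pt d} (hv : v ∈ T.vertices)
    (hw : w ∈ T.vertices) (hwv : w ≠ v) (hx₀ : 0 < gap v w x₀) :
    volume (T.facePyramid v w x₀) =
      ENNReal.ofReal (gap v w x₀ / ‖w - v‖ / d) * surf (T.face v w) :=
  volume_pyramid hd (sub_ne_zero.2 hwv) hx₀ (isClosed_face v w).measurableSet
    fun _ hx => inner_sub_eq_gap hv hw hx

/-- A point of a face pyramid lies on a segment from the apex to the face. -/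
theorem exists_of_mem_facePyramid {v w x₀ x : Pt d} (hx₀ : 0 < gap v w x₀)
    (hx : x ∈ T.facePyramid v w x₀) :
    ∃ f ∈ T.face v w, ∃ s : ℝ, 0 < s ∧ s ≤ 1 ∧ x = x₀ + s • (f - x₀) := by
  obtain ⟨h1, h2, h3⟩ := hx
  refine ⟨_, h3, inner ℝ (w - v) (x - x₀) / gap v w x₀, by positivity,
    (div_le_one hx₀).2 h2, ?_⟩
  rw [add_sub_cancel_left, smul_smul, div_mul_div_cancel₀ hx₀.ne', div_self h1.ne', one_smul,
    add_sub_cancel]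

/-- Every gap is affine, positive at the apex and nonnegative on the face, hence nonnegative on the
segments between them. -/
theorem facePyramid_subset_box {v w x₀ : Pt d} (hx₀ : ∀ u ∈ T.vertices, u ≠ v → 0 < gap v u x₀)
    (hw : w ∈ T.vertices) (hwv : w ≠ v) : T.facePyramid v w x₀ ⊆ T.box v := by
  intro x hx
  obtain ⟨f, hf, s, hs0, hs1, rfl⟩ := exists_of_mem_facePyramid (hx₀ w hw hwv) hx
  rw [mem_box_iff]
  intro u hu
  rw [gap_lineMap]
  have h1 := mem_box_iff.1 hf.1 u hu
  rcases eq_or_ne u v with rfl | huv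
  · simp [gap]
  · have := hx₀ u hu huv
    nlinarith

/-- On a common point the rays through the two faces leave the box at the same parameter, which is
one linear equation in `x - x₀`; the overlap therefore lies in a hyperplane through the apex. -/
theorem volume_facePyramid_inter {v w u x₀ : Pt d}
    (hx₀ : ∀ u ∈ T.vertices, u ≠ v → 0 < gap v u x₀)
    (hv : v ∈ T.vertices) (hw : w ∈ T.vertices) (hwv : w ≠ v) (hu : u ∈ T.vertices) (huv : u ≠ v)
    (hne : w ≠ u) : volume (T.facePyramid v w x₀ ∩ T.facePyramid v u x₀) = 0 := by
  have hw0 := hx₀ w hw hwv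
  have hu0 := hx₀ u hu huv
  -- The equation is not trivial: otherwise `w - v = r • (u - v)` with the gaps in the same ratio
  -- `r`, and since a gap has a quadratic part this forces `r = 1`, so `w = u`.
  have hm : gap v u x₀ • (w - v) - gap v w x₀ • (u - v) ≠ 0 := by
    intro h
    have h1 : w - v = (gap v w x₀ / gap v u x₀) • (u - v) := by
      rw [sub_eq_zero] at h
      rw [div_eq_inv_mul, ← smul_smul, ← h, smul_smul, inv_mul_cancel₀ hu0.ne', one_smul]
    set r := gap v w x₀ / gap v u x₀ with hr
    have hr0 : 0 < r := by positivity
    have h2 : gap v w x₀ = r * gap v u x₀ := by rw [hr]; field_simp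
    have hun : 0 < ‖u - v‖ := by rw [norm_pos_iff, sub_ne_zero]; exact huv
    rw [gap, gap, h1, norm_smul, real_inner_smul_left, Real.norm_of_nonneg hr0.le] at h2
    have h3 : r = 1 := by
      have : r * ‖u - v‖ ^ 2 * (r - 1) = 0 := by linear_combination 2 * h2
      rcases mul_eq_zero.1 this with h | h
      · have : 0 < r * ‖u - v‖ ^ 2 := by positivity
        exact absurd h this.ne'
      · linarith
    rw [h3, one_smul] at h1
    exact hne (sub_left_injective h1)
  refine measure_mono_null ?_ (volume_hyperplane_eq_zero hm x₀)
  rintro x ⟨hxw, hxu⟩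
  obtain ⟨f, hf, s, hs0, hs1, hxf⟩ := exists_of_mem_facePyramid hw0 hxw
  obtain ⟨g, hg, s', hs0', hs1', hxg⟩ := exists_of_mem_facePyramid hu0 hxu
  have e1 : inner ℝ (w - v) (x - x₀) = s * gap v w x₀ := by
    rw [hxf, add_sub_cancel_left, real_inner_smul_right, inner_sub_eq_gap hv hw hf]
  have e2 : inner ℝ (u - v) (x - x₀) = s' * gap v u x₀ := by
    rw [hxg, add_sub_cancel_left, real_inner_smul_right, inner_sub_eq_gap hv hu hg]
  have e3 : inner ℝ (u - v) (x - x₀) ≤ s * gap v u x₀ := by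
    rw [hxf, add_sub_cancel_left, real_inner_smul_right, ← gap_sub_gap]
    have := mem_box_iff.1 hf.1 u hu
    nlinarith
  have e4 : inner ℝ (w - v) (x - x₀) ≤ s' * gap v w x₀ := by
    rw [hxg, add_sub_cancel_left, real_inner_smul_right, ← gap_sub_gap]
    have := mem_box_iff.1 hg.1 w hw
    nlinarith
  have hss : s = s' := by
    rw [e1] at e4
    rw [e2] at e3
    exact le_antisymm (le_of_mul_le_mul_right e4 hw0) (le_of_mul_le_mul_right e3 hu0)
  simp only [Set.mem_ofPred_eq]
  rw [inner_sub_left, real_inner_smul_left, real_inner_smul_left, e1, e2, hss]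
  ring

/-- The box is covered by the pyramids over its faces. -/
theorem box_subset_iUnion_facePyramid (hΩ : IsOpen Ω) {v x₀ : Pt d} (hvΩ : v ∈ Ω)
    (hv : v ∈ T.vertices) (hx₀ : ∀ u ∈ T.vertices, u ≠ v → 0 < gap v u x₀) :
    T.box v ⊆ {x₀} ∪ ⋃ w ∈ T.vertices.erase v, T.facePyramid v w x₀ := by
  intro x hx
  rcases eq_or_ne x x₀ with rfl | hxx
  · exact Or.inl rfl
  right
  have hne : x - x₀ ≠ 0 := sub_ne_zero.2 hxx
  obtain ⟨ε, hε, hεy⟩ := T.exists_vertex_inner_ge hΩ hvΩ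
  obtain ⟨w₁, hw₁, hw₁x⟩ := hεy (x - x₀)
  have hpos : 0 < inner ℝ (w₁ - v) (x - x₀) := lt_of_lt_of_le (by positivity) hw₁x
  have hw₁v : w₁ ≠ v := by rintro rfl; simp at hpos
  -- The ray from `x₀` through `x` leaves the box through the first bisector it meets, the one
  -- maximizing this ratio; `w₁` guarantees that some bisector is met.
  obtain ⟨w, hw, hmax⟩ := (T.vertices.erase v).exists_max_image
    (fun w => inner ℝ (w - v) (x - x₀) / gap v w x₀) ⟨w₁, Finset.mem_erase.2 ⟨hw₁v, hw₁⟩⟩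
  obtain ⟨hwv, hwV⟩ := Finset.mem_erase.1 hw
  have hw0 := hx₀ w hwV hwv
  have hwpos : 0 < inner ℝ (w - v) (x - x₀) := by
    have h1 := hmax w₁ (Finset.mem_erase.2 ⟨hw₁v, hw₁⟩)
    have h2 : 0 < inner ℝ (w₁ - v) (x - x₀) / gap v w₁ x₀ := div_pos hpos (hx₀ w₁ hw₁ hw₁v)
    exact (div_pos_iff_of_pos_right hw0).1 (h2.trans_le h1)
  refine Set.mem_iUnion₂.2 ⟨w, hw, hwpos, ?_, ?_⟩
  · rw [← gap_sub_gap]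
    linarith [mem_box_iff.1 hx w hwV]
  · rw [mem_face_iff hv hwV]
    constructor
    · rw [mem_box_iff]
      intro u hu
      rcases eq_or_ne u v with rfl | huv
      · simp [gap]
      · have hu0 := hx₀ u hu huv
        have h1 := hmax u (Finset.mem_erase.2 ⟨huv, hu⟩)
        rw [gap_lineMap, gap_sub_gap, sub_nonneg, div_mul_eq_mul_div, div_le_iff₀ hwpos]
        rw [div_le_div_iff₀ hu0 hw0] at h1
        linarith
    · rw [gap_lineMap, gap_sub_gap, div_mul_cancel₀ _ hwpos.ne', sub_self]

theorem measurableSet_facePyramid (v w x₀ : Pt d) : MeasurableSet (T.facePyramid v w x₀) :=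
  measurableSet_pyramid _ _ _ (isClosed_face v w).measurableSet

theorem gap_self_pos {v u : Pt d} (huv : u ≠ v) : 0 < gap v u v := by
  have : 0 < ‖u - v‖ := norm_pos_iff.2 (sub_ne_zero.2 huv)
  rw [gap, sub_self, inner_zero_right, sub_zero]
  exact half_pos (pow_pos this 2)

/-- An infinite base would give infinite volume to a pyramid of positive height inside a bounded
box. Finiteness matters because `Measure.real` sends `⊤` to `0`, so zero `faceArea` alone would not
mean a null face. -/
theorem surf_face_lt_top (hd : 1 ≤ d) (hΩ : IsOpen Ω) {v w : Pt d} (hvΩ : v ∈ Ω)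
    (hv : v ∈ T.vertices) (hw : w ∈ T.vertices) (hwv : w ≠ v) : surf (T.face v w) < ⊤ := by
  have hgap : ∀ u ∈ T.vertices, u ≠ v → 0 < gap v u v := fun u _ huv => gap_self_pos huv
  have h1 := measure_mono (μ := volume) (facePyramid_subset_box hgap hw hwv)
  rw [volume_facePyramid hd hv hw hwv (hgap w hw hwv)] at h1
  have h2 := h1.trans_lt (volume_box_lt_top hΩ hvΩ)
  have h3 : 0 < ENNReal.ofReal (gap v w v / ‖w - v‖ / d) := by
    have : 0 < ‖w - v‖ := by rw [norm_pos_iff, sub_ne_zero]; exact hwv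
    have := hgap w hw hwv
    have : 0 < d := hd
    rw [ENNReal.ofReal_pos]
    positivity
  by_contra h
  rw [not_lt, top_le_iff] at h
  rw [h, ENNReal.mul_top h3.ne'] at h2
  exact lt_irrefl _ h2

theorem faceArea_eq_zero {v w : Pt d} (hw : w ∈ T.vertices) (hwv : w ≠ v)
    (hn : w ∉ T.neighbours v) : T.faceArea v w = 0 := by
  by_contra h
  exact hn (mem_neighbours.2 ⟨hw, hwv, lt_of_le_of_ne measureReal_nonneg (Ne.symm h)⟩)

/-- The volume of a box as the sum of the volumes of its face pyramids. -/
theorem boxVol_eq_sum (hd : 1 ≤ d) (hΩ : IsOpen Ω) {v x₀ : Pt d} (hvΩ : v ∈ Ω)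
    (hv : v ∈ T.vertices) (hx₀ : ∀ u ∈ T.vertices, u ≠ v → 0 < gap v u x₀) :
    d * T.boxVol v = ∑ w ∈ T.neighbours v, gap v w x₀ / dist v w * T.faceArea v w := by
  have hd0 : 0 < (d : ℝ) := by exact_mod_cast hd
  have : Nonempty (Fin d) := ⟨⟨0, hd⟩⟩
  have : Nontrivial (Pt d) := inferInstance
  have h1 : volume (T.box v) = volume (⋃ w ∈ T.vertices.erase v, T.facePyramid v w x₀) := by
    apply le_antisymm
    · refine (measure_mono (box_subset_iUnion_facePyramid hΩ hvΩ hv hx₀)).trans ?_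
      refine (measure_union_le _ _).trans ?_
      simp
    · refine measure_mono (Set.iUnion₂_subset fun w hw => ?_)
      exact facePyramid_subset_box hx₀ (Finset.mem_of_mem_erase hw) (Finset.ne_of_mem_erase hw)
  rw [measure_biUnion_finset₀] at h1
  · rw [boxVol, Measure.real, h1, ENNReal.toReal_sum, Finset.mul_sum]
    · rw [← Finset.sum_subset (s₁ := T.neighbours v) (s₂ := T.vertices.erase v)]
      · refine Finset.sum_congr rfl fun w hw => ?_
        obtain ⟨hwV, hwv, -⟩ := mem_neighbours.1 hw
        have h0 := hx₀ w hwV hwv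
        rw [volume_facePyramid hd hv hwV hwv h0, ENNReal.toReal_mul,
          ENNReal.toReal_ofReal (by positivity), faceArea, Measure.real, dist_comm,
          dist_eq_norm]
        field_simp
      · intro w hw
        obtain ⟨hwV, hwv, -⟩ := mem_neighbours.1 hw
        exact Finset.mem_erase.2 ⟨hwv, hwV⟩
      · intro w hw hn
        obtain ⟨hwv, hwV⟩ := Finset.mem_erase.1 hw
        rw [volume_facePyramid hd hv hwV hwv (hx₀ w hwV hwv), ENNReal.toReal_mul]
        have := faceArea_eq_zero hwV hwv hn
        rw [faceArea, Measure.real] at this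
        rw [this, mul_zero, mul_zero]
    · intro w hw
      exact ((measure_mono (facePyramid_subset_box hx₀ (Finset.mem_of_mem_erase hw)
        (Finset.ne_of_mem_erase hw))).trans_lt (volume_box_lt_top hΩ hvΩ)).ne
  · intro w hw u hu hne
    exact volume_facePyramid_inter hx₀ hv (Finset.mem_of_mem_erase hw) (Finset.ne_of_mem_erase hw)
      (Finset.mem_of_mem_erase hu) (Finset.ne_of_mem_erase hu) hne
  · exact fun w _ => (measurableSet_facePyramid v w x₀).nullMeasurableSet

/-- The pyramid decomposition with apex `v`, where each height is `d_ij / 2`. -/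
theorem sum_dist_mul_faceArea (hd : 1 ≤ d) (hΩ : IsOpen Ω) {v : Pt d} (hvΩ : v ∈ Ω)
    (hv : v ∈ T.vertices) :
    ∑ w ∈ T.neighbours v, dist v w * T.faceArea v w = 2 * d * T.boxVol v := by
  rw [mul_assoc, boxVol_eq_sum hd hΩ hvΩ hv (fun u _ huv => gap_self_pos huv), Finset.mul_sum]
  refine Finset.sum_congr rfl fun w hw => ?_
  obtain ⟨hwV, hwv, -⟩ := mem_neighbours.1 hw
  have : 0 < dist v w := dist_pos.2 hwv.symm
  rw [gap, sub_self, inner_zero_right, ← dist_eq_norm, dist_comm w v]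
  field_simp
  ring

/-- Minkowski's relation: the area-weighted normals of a box sum to zero. -/
theorem sum_faceArea_smul_normal (hd : 1 ≤ d) (hΩ : IsOpen Ω) {v : Pt d} (hvΩ : v ∈ Ω)
    (hv : v ∈ T.vertices) :
    ∑ w ∈ T.neighbours v, T.faceArea v w • normal v w = 0 := by
  set S := ∑ w ∈ T.neighbours v, T.faceArea v w • normal v w with hS
  -- Moving the apex from `v` by `ε • S` keeps all gaps positive for small `ε`. Comparing the two
  -- volume formulas then gives `ε ‖S‖² = 0`.
  have hev : ∀ᶠ ε : ℝ in nhdsWithin 0 (Set.Ioi 0),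
      ∀ u ∈ T.vertices.erase v, 0 < gap v u (v + ε • S) := by
    rw [Filter.eventually_all_finset]
    intro u hu
    refine Filter.Tendsto.eventually_const_lt (gap_self_pos (Finset.ne_of_mem_erase hu)) ?_
    have hc : Continuous fun ε : ℝ => gap v u (v + ε • S) := by unfold gap; fun_prop
    have := hc.tendsto 0
    rw [zero_smul, add_zero] at this
    exact this.mono_left nhdsWithin_le_nhds
  obtain ⟨ε, hε, hε0⟩ := (hev.and self_mem_nhdsWithin).exists
  have h1 := boxVol_eq_sum hd hΩ hvΩ hv (x₀ := v + ε • S)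
    (fun u hu huv => hε u (Finset.mem_erase.2 ⟨huv, hu⟩))
  rw [boxVol_eq_sum hd hΩ hvΩ hv (fun u _ huv => gap_self_pos huv), ← sub_eq_zero,
    ← Finset.sum_sub_distrib] at h1
  have h2 : ε * inner ℝ S S = 0 := by
    rw [← h1]
    nth_rewrite 1 [hS]
    rw [sum_inner, Finset.mul_sum]
    refine Finset.sum_congr rfl fun w _ => ?_
    rw [← sub_mul, ← sub_div, gap_sub_gap, add_sub_cancel_left, real_inner_smul_left, normal,
      real_inner_smul_left, real_inner_smul_right]
    ring
  rcases mul_eq_zero.1 h2 with h | h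
  · exact absurd h (ne_of_gt hε0)
  · exact inner_self_eq_zero.1 h

end Triangulation

end RhieChow

end

/-! ### Elements, faces and piecewise affine functions. -/

noncomputable section

namespace RhieChow

namespace Triangulation

variable {d : ℕ} {Ω : Set (Pt d)} {T : Triangulation Ω}

theorem convex_cell (t : Finset (Pt d)) : Convex ℝ (cell t) := convex_convexHull ℝ _

theorem isCompact_cell (t : Finset (Pt d)) : IsCompact (cell t) :=
  t.finite_toSet.isCompact_convexHull ℝ

theorem subset_cell (t : Finset (Pt d)) : (t : Set (Pt d)) ⊆ cell t := subset_convexHull ℝ _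

theorem cell_subset_closure {t : Finset (Pt d)} (ht : t ∈ T.elements) : cell t ⊆ closure Ω := by
  rw [T.closure_eq_iUnion]
  exact Set.subset_biUnion_of_mem (u := fun t : Finset (Pt d) => cell t) ht

theorem interior_cell_subset (hΩ : IsPolyhedralDomain Ω) {t : Finset (Pt d)}
    (ht : t ∈ T.elements) : interior (cell t) ⊆ Ω := by
  rw [← hΩ.interior_closure]
  exact interior_mono (cell_subset_closure ht)

/-- The vertices of an element as an affine basis; its coordinates are the barycentric ones. -/
def elementBasis {t : Finset (Pt d)} (ht : t ∈ T.elements) : AffineBasis t ℝ (Pt d) where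
  toFun := (↑)
  ind' := T.complex.indep (mem_elements.1 ht).1
  tot' := by
    rw [(T.complex.indep (mem_elements.1 ht).1).affineSpan_eq_top_iff_card_eq_finrank_add_one,
      finrank_euclideanSpace_fin, Fintype.card_coe, (mem_elements.1 ht).2]

theorem elementBasis_apply {t : Finset (Pt d)} (ht : t ∈ T.elements) (u : t) :
    elementBasis ht u = u := rfl

theorem range_elementBasis {t : Finset (Pt d)} (ht : t ∈ T.elements) :
    Set.range (elementBasis ht) = t := Subtype.range_coe

theorem mem_cell_iff {t : Finset (Pt d)} (ht : t ∈ T.elements) {x : Pt d} :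
    x ∈ cell t ↔ ∀ u : t, 0 ≤ (elementBasis ht).coord u x := by
  rw [cell, ← range_elementBasis ht, AffineBasis.convexHull_eq_nonneg_coord]
  rfl

theorem mem_interior_cell_iff {t : Finset (Pt d)} (ht : t ∈ T.elements) {x : Pt d} :
    x ∈ interior (cell t) ↔ ∀ u : t, 0 < (elementBasis ht).coord u x := by
  rw [cell, ← range_elementBasis ht, AffineBasis.interior_convexHull]
  rfl

/-- Common points lie in the hull of the shared vertices, where the barycentric coordinate of a
vertex of `t` outside `t'` vanishes; in the interior of `t` that coordinate is positive. -/
theorem disjoint_interior_cell {t t' : Finset (Pt d)} (ht : t ∈ T.elements)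
    (ht' : t' ∈ T.elements) (hne : t ≠ t') :
    Disjoint (interior (cell t)) (interior (cell t')) := by
  rw [Set.disjoint_left]
  intro x hx hx'
  have h1 := T.complex.inter_subset_convexHull (mem_elements.1 ht).1 (mem_elements.1 ht').1
    ⟨interior_subset hx, interior_subset hx'⟩
  obtain ⟨u, hu, hu'⟩ : ∃ u ∈ t, u ∉ t' := by
    by_contra! h
    exact hne (Finset.eq_of_subset_of_card_le h
      (by rw [(mem_elements.1 ht).2, (mem_elements.1 ht').2]))
  have h2 : ((t : Set (Pt d)) ∩ t') ⊆ (elementBasis ht).coord ⟨u, hu⟩ ⁻¹' {0} := by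
    rintro y ⟨hy, hy'⟩
    have hne : (⟨u, hu⟩ : t) ≠ ⟨y, hy⟩ := by
      intro h
      rw [Subtype.mk.injEq] at h
      exact hu' (h ▸ hy')
    have := (elementBasis ht).coord_apply_ne hne
    rwa [elementBasis_apply] at this
  have h3 := convexHull_min h2 ((convex_singleton 0).affine_preimage _) h1
  rw [Set.mem_preimage, Set.mem_singleton_iff] at h3
  exact ((mem_interior_cell_iff ht).1 hx ⟨u, hu⟩).ne' h3

theorem volume_cell_diff_interior (t : Finset (Pt d)) : volume (cell t \ interior (cell t)) = 0 := by
  have := (convex_cell t).addHaar_frontier volume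
  rwa [frontier, (isCompact_cell t).isClosed.closure_eq] at this

theorem diam_cell_le_meshSize {t : Finset (Pt d)} (ht : t ∈ T.elements) :
    Metric.diam (cell t) ≤ T.meshSize :=
  le_ciSup (f := fun t : T.elements => Metric.diam (cell (t : Finset (Pt d))))
    (Set.finite_range _).bddAbove ⟨t, ht⟩

theorem dist_le_meshSize {t : Finset (Pt d)} (ht : t ∈ T.elements) {x y : Pt d} (hx : x ∈ t)
    (hy : y ∈ t) : dist x y ≤ T.meshSize :=
  (Metric.dist_le_diam_of_mem (isCompact_cell t).isBounded (subset_cell t hx)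
    (subset_cell t hy)).trans (diam_cell_le_meshSize ht)

theorem elements_nonempty (hΩ : IsPolyhedralDomain Ω) : T.elements.Nonempty := by
  obtain ⟨x, hx⟩ := hΩ.isConnected.nonempty
  have h := subset_closure hx
  rw [T.closure_eq_iUnion] at h
  obtain ⟨t, ht, -⟩ := Set.mem_iUnion₂.1 h
  exact ⟨t, ht⟩

theorem meshSize_nonneg : 0 ≤ T.meshSize := Real.iSup_nonneg fun _ => Metric.diam_nonneg

theorem meshSize_le_diam (hΩ : IsPolyhedralDomain Ω) : T.meshSize ≤ Metric.diam (closure Ω) := by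
  obtain ⟨t, ht⟩ := T.elements_nonempty hΩ
  have : Nonempty T.elements := ⟨⟨t, ht⟩⟩
  exact ciSup_le fun t => Metric.diam_mono (cell_subset_closure t.2) hΩ.isBounded.closure

/-! ### Faces -/

/-- A face meets a hyperplane through one of its two vertices in a null set. -/
theorem surf_face_inter_eq_zero (hd : 1 ≤ d) {v w : Pt d} (hv : v ∈ T.vertices)
    (hw : w ∈ T.vertices) (hwv : w ≠ v) {N : AffineSubspace ℝ (Pt d)} (hN : N ≠ ⊤)
    (hvN : v ∈ N) : surf (T.face v w ∩ (N : Set (Pt d))) = 0 := by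
  have hd' : 0 < d := hd
  have hnorm : 0 < ‖w - v‖ := norm_pos_iff.2 (sub_ne_zero.2 hwv)
  have h0 : 0 < gap v w v := gap_self_pos hwv
  have h1 := volume_pyramid (x₀ := v) hd (sub_ne_zero.2 hwv) h0
    ((isClosed_face (T := T) v w).inter N.closed_of_finiteDimensional).measurableSet
    fun x hx => inner_sub_eq_gap hv hw hx.1
  -- Apex and base both lie in `N`, hence so does the pyramid; its height is positive, so its base
  -- must be null.
  have h2 : volume (pyramid v (w - v) (gap v w v) (T.face v w ∩ (N : Set (Pt d)))) = 0 := by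
    refine measure_mono_null (fun x hx => ?_) (Measure.addHaar_affineSubspace volume N hN)
    obtain ⟨hx1, -, -, hx2⟩ := hx
    have h3 := AffineMap.lineMap_mem (inner ℝ (w - v) (x - v) / gap v w v) hvN hx2
    rwa [AffineMap.lineMap_apply, vsub_eq_sub, vadd_eq_add, add_sub_cancel_left, smul_smul,
      div_mul_div_cancel₀ h0.ne', div_self hx1.ne', one_smul, sub_add_cancel] at h3
  rw [h2] at h1
  rcases mul_eq_zero.1 h1.symm with h | h
  · rw [ENNReal.ofReal_eq_zero] at h
    have : 0 < gap v w v / ‖w - v‖ / d := by positivity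
    linarith
  · exact h

/-- Positive area forces the face to span the whole bisector: otherwise the face and `v` would lie
in a proper affine subspace, and the face would be null. -/
theorem midpoint_mem_affineSpan_face (hd : 1 ≤ d) {v w : Pt d} (hv : v ∈ T.vertices)
    (hw : w ∈ T.neighbours v) : midpoint ℝ v w ∈ affineSpan ℝ (T.face v w) := by
  obtain ⟨hwV, hwv, hpos⟩ := mem_neighbours.1 hw
  have hne : surf (T.face v w) ≠ 0 := by
    intro h
    rw [faceArea, Measure.real, h] at hpos
    simp at hpos
  have htop : affineSpan ℝ (insert v (affineSpan ℝ (T.face v w) : Set (Pt d))) = ⊤ := by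
    by_contra hN
    apply hne
    have := surf_face_inter_eq_zero hd hv hwV hwv hN
      (subset_affineSpan ℝ _ (Set.mem_insert _ _))
    rwa [Set.inter_eq_left.2] at this
    exact (subset_affineSpan ℝ _).trans ((Set.subset_insert _ _).trans (subset_affineSpan ℝ _))
  obtain ⟨f, hf⟩ : (T.face v w).Nonempty := by
    by_contra h
    rw [Set.not_nonempty_iff_eq_empty] at h
    exact hne (by rw [h, measure_empty])
  have hfix : ∀ y ∈ affineSpan ℝ (T.face v w),
      inner ℝ (w - v) (y - v) = ‖w - v‖ ^ 2 / 2 := by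
    intro y hy
    let φ : Pt d →ᵃ[ℝ] ℝ :=
      (innerSL ℝ (w - v)).toLinearMap.toAffineMap.comp
        (AffineMap.id ℝ (Pt d) - AffineMap.const ℝ (Pt d) v)
    have hle : affineSpan ℝ (T.face v w) ≤
        (affineSpan ℝ {‖w - v‖ ^ 2 / 2}).comap φ := by
      rw [affineSpan_le]
      intro z hz
      rw [SetLike.mem_coe, AffineSubspace.mem_comap, AffineSubspace.mem_affineSpan_singleton]
      have := inner_sub_eq_gap (x₀ := v) hv hwV hz
      rw [gap, sub_self, inner_zero_right, sub_zero] at this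
      exact this
    have := hle hy
    rw [AffineSubspace.mem_comap, AffineSubspace.mem_affineSpan_singleton] at this
    exact this
  have hmid : midpoint ℝ v w ∈ affineSpan ℝ (insert v (affineSpan ℝ (T.face v w) : Set (Pt d))) := by
    rw [htop]; trivial
  have hf' := subset_affineSpan ℝ _ hf
  rw [AffineSubspace.mem_affineSpan_insert_iff hf'] at hmid
  -- Here `r` is the coefficient of `v - f`. Pairing with `w - v`, which is constant on the span of
  -- the face, shows `r = 0`.
  obtain ⟨r, y, hy, hm⟩ := hmid
  have h1 : inner ℝ (w - v) (midpoint ℝ v w - v) = ‖w - v‖ ^ 2 / 2 := by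
    rw [midpoint_sub_left, invOf_eq_inv, real_inner_smul_right, real_inner_self_eq_norm_sq]
    ring
  rw [hm, vsub_eq_sub, vadd_eq_add, add_sub_assoc, inner_add_right, real_inner_smul_right,
    hfix y hy, ← neg_sub f v, inner_neg_right, hfix f hf'] at h1
  have hnorm : 0 < ‖w - v‖ ^ 2 := pow_pos (norm_pos_iff.2 (sub_ne_zero.2 hwv)) 2
  have hr : r = 0 := by
    have : r * ‖w - v‖ ^ 2 = 0 := by linarith
    exact (mul_eq_zero.1 this).resolve_right hnorm.ne'
  rw [hm, hr, zero_smul, zero_vadd]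
  exact hy

theorem weight_nonneg (v w : Pt d) : 0 ≤ T.weight v w :=
  div_nonneg Metric.infDist_nonneg dist_nonneg

theorem weight_le_half (hd : 1 ≤ d) {v w : Pt d} (hv : v ∈ T.vertices)
    (hw : w ∈ T.neighbours v) : T.weight v w ≤ 1 / 2 := by
  have hdist : 0 < dist v w := dist_pos.2 (mem_neighbours.1 hw).2.1.symm
  rw [weight, div_le_iff₀ hdist]
  refine (Metric.infDist_le_dist_of_mem (midpoint_mem_affineSpan_face hd hv hw)).trans ?_
  rw [dist_right_midpoint]
  norm_num

/-- Up to a null set a face lies in the interiors of the elements around its edge. -/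
theorem ae_face_mem_interior (hd : 1 ≤ d) {σ : ℝ} (hT : T.IsRegular σ) {v w : Pt d}
    (hv : v ∈ T.interiorVertices) (hw : w ∈ T.neighbours v) :
    ∀ᵐ x ∂surf.restrict (T.face v w), ∃ t ∈ T.elements, v ∈ t ∧ w ∈ t ∧ x ∈ interior (cell t) := by
  obtain ⟨hwV, hwv, -⟩ := mem_neighbours.1 hw
  have hvV := (mem_interiorVertices.1 hv).1
  -- The hyperplane `coord u = 0` passes through `v`, or through `w` if `u = v`, so it meets the
  -- face in a null set.
  have hnull : ∀ t : Finset (Pt d), ∀ u : t, ∀ᵐ x ∂surf.restrict (T.face v w),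
      ∀ ht : t ∈ T.elements, v ∈ t → w ∈ t → (elementBasis ht).coord u x ≠ 0 := by
    intro t u
    by_cases h : t ∈ T.elements ∧ v ∈ t ∧ w ∈ t
    · obtain ⟨ht, hvt, hwt⟩ := h
      set N : AffineSubspace ℝ (Pt d) := (affineSpan ℝ {0}).comap ((elementBasis ht).coord u)
      have hmemN : ∀ y, y ∈ N ↔ (elementBasis ht).coord u y = 0 := fun y => by
        rw [AffineSubspace.mem_comap, AffineSubspace.mem_affineSpan_singleton]
      have hN : N ≠ ⊤ := by
        intro h
        have : (u : Pt d) ∈ N := by rw [h]; trivial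
        rw [hmemN, ← elementBasis_apply ht u, AffineBasis.coord_apply_eq] at this
        exact one_ne_zero this
      have hz : surf (T.face v w ∩ (N : Set (Pt d))) = 0 := by
        by_cases huv : (u : Pt d) = v
        · rw [face_comm]
          refine surf_face_inter_eq_zero hd hwV hvV hwv.symm hN ?_
          rw [hmemN]
          refine (elementBasis ht).coord_apply_ne (j := ⟨w, hwt⟩) fun h => ?_
          rw [h] at huv
          exact hwv huv
        · refine surf_face_inter_eq_zero hd hvV hwV hwv hN ?_
          rw [hmemN]
          refine (elementBasis ht).coord_apply_ne (j := ⟨v, hvt⟩) fun h => ?_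
          rw [h] at huv
          exact huv rfl
      rw [ae_restrict_iff' (isClosed_face v w).measurableSet, ae_iff]
      refine measure_mono_null (fun x hx => ?_) hz
      rw [Set.mem_ofPred_eq] at hx
      push Not at hx
      obtain ⟨hx1, ht', -, -, hx2⟩ := hx
      exact ⟨hx1, (hmemN x).2 hx2⟩
    · exact Filter.Eventually.of_forall fun x h1 h2 h3 => absurd ⟨h1, h2, h3⟩ h
  have hall : ∀ᵐ x ∂surf.restrict (T.face v w), ∀ t ∈ T.elements, ∀ u : t,
      ∀ ht : t ∈ T.elements, v ∈ t → w ∈ t → (elementBasis ht).coord u x ≠ 0 := by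
    rw [Filter.eventually_all_finset]
    intro t _
    rw [Filter.eventually_all]
    exact hnull t
  filter_upwards [hall, self_mem_ae_restrict (isClosed_face v w).measurableSet] with x hx hxF
  obtain ⟨t, ht, hvt, hwt, hxt⟩ := hT.face_subset v hv w hw x hxF
  refine ⟨t, ht, hvt, hwt, (mem_interior_cell_iff ht).2 fun u => ?_⟩
  exact lt_of_le_of_ne ((mem_cell_iff ht).1 hxt u) (hx t ht u ht hvt hwt).symm

/-- Up to a null set the box of `v` lies in the interiors of the elements around `v`. -/
theorem ae_box_mem_interior (hd : 1 ≤ d) (hΩ : IsOpen Ω) {σ : ℝ} (hT : T.IsRegular σ) {v : Pt d}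
    (hv : v ∈ T.interiorVertices) :
    ∀ᵐ x ∂volume.restrict (T.box v), ∃ t ∈ T.elements, v ∈ t ∧ x ∈ interior (cell t) := by
  obtain ⟨hvV, hvΩ⟩ := mem_interiorVertices.1 hv
  have : Nonempty (Fin d) := ⟨⟨0, hd⟩⟩
  have h1 : ∀ᵐ x : Pt d, x ≠ v := by
    rw [ae_iff]; simp
  have h2 : ∀ᵐ x : Pt d, ∀ w ∈ T.vertices.erase v, w ∉ T.neighbours v →
      x ∉ T.facePyramid v w v := by
    rw [Filter.eventually_all_finset]
    intro w hw
    obtain ⟨hwv, hwV⟩ := Finset.mem_erase.1 hw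
    by_cases hn : w ∈ T.neighbours v
    · exact Filter.Eventually.of_forall fun x h => absurd hn h
    · have hz := faceArea_eq_zero hwV hwv hn
      rw [faceArea, measureReal_eq_zero_iff (surf_face_lt_top hd hΩ hvΩ hvV hwV hwv).ne] at hz
      have h3 := volume_facePyramid hd hvV hwV hwv (gap_self_pos hwv)
      rw [hz, mul_zero] at h3
      filter_upwards [measure_eq_zero_iff_ae_notMem.1 h3] with x hx _ using hx
  have h3 : ∀ᵐ x : Pt d, ∀ t ∈ T.elements, x ∉ cell t \ interior (cell t) := by
    rw [Filter.eventually_all_finset]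
    exact fun t _ => measure_eq_zero_iff_ae_notMem.1 (volume_cell_diff_interior t)
  rw [ae_restrict_iff' (isClosed_box v).measurableSet]
  filter_upwards [h1, h2, h3] with x hx1 hx2 hx3 hxB
  have hgap : ∀ u ∈ T.vertices, u ≠ v → 0 < gap v u v := fun u _ huv => gap_self_pos huv
  rcases box_subset_iUnion_facePyramid hΩ hvΩ hvV hgap hxB with h | h
  · exact absurd h hx1
  obtain ⟨w, hw, hxw⟩ := Set.mem_iUnion₂.1 h
  obtain ⟨hwv, hwV⟩ := Finset.mem_erase.1 hw
  have hn : w ∈ T.neighbours v := by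
    by_contra hn
    exact hx2 w hw hn hxw
  -- `x` lies on the segment from `v` to `f`, and an element containing both endpoints contains it
  -- by convexity.
  obtain ⟨f, hf, s, hs0, hs1, hxs⟩ := exists_of_mem_facePyramid (gap_self_pos hwv) hxw
  obtain ⟨t, ht, hvt, -, hft⟩ := hT.face_subset v hv w hn f hf
  refine ⟨t, ht, hvt, ?_⟩
  have hxt : x ∈ cell t := by
    rw [hxs]
    exact (convex_cell t).add_smul_sub_mem (subset_cell t hvt) hft ⟨hs0.le, hs1⟩
  by_contra hcon
  exact hx3 t ht ⟨hxt, hcon⟩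

/-! ### Piecewise affine functions -/

/-- `G` collects the gradients of `q` on the elements. -/
structure IsElementGradient (T : Triangulation Ω) (q : Pt d → ℝ) (G : Finset (Pt d) → Pt d) :
    Prop where
  sub_eq : ∀ t ∈ T.elements, ∀ x ∈ cell t, ∀ y ∈ cell t, q y - q x = inner ℝ (G t) (y - x)
  hasGradientAt : ∀ t ∈ T.elements, ∀ x ∈ interior (cell t), HasGradientAt q (G t) x

theorem IsP1.exists_isElementGradient {q : Pt d → ℝ} (hq : T.IsP1 q) :
    ∃ G, T.IsElementGradient q G := by
  have h : ∀ t : Finset (Pt d), ∃ g : Pt d →ᵃ[ℝ] ℝ, t ∈ T.elements → Set.EqOn q g (cell t) := by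
    intro t
    by_cases ht : t ∈ T.elements
    · obtain ⟨g, hg⟩ := hq.2 t ht
      exact ⟨g, fun _ => hg⟩
    · exact ⟨AffineMap.const ℝ _ 0, fun h => absurd h ht⟩
  choose g hg using h
  have hG : ∀ t, ∃ v : Pt d, ∀ y, inner ℝ v y = (g t).linear y := fun t =>
    ⟨(InnerProductSpace.toDual ℝ (Pt d)).symm (LinearMap.toContinuousLinearMap (g t).linear),
      fun y => by rw [InnerProductSpace.toDual_symm_apply]; rfl⟩
  choose G hG using hG
  have hdiff : ∀ t x y, g t y - g t x = inner ℝ (G t) (y - x) := fun t x y => by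
    rw [hG, ← vsub_eq_sub y x, AffineMap.linearMap_vsub, vsub_eq_sub]
  refine ⟨G, fun t ht x hx y hy => ?_, fun t ht x hx => ?_⟩
  · rw [hg t ht hx, hg t ht hy, hdiff]
  · rw [hasGradientAt_iff_hasFDerivAt]
    have h1 : HasFDerivAt (fun y => inner ℝ (G t) (y - x) + g t x)
        (InnerProductSpace.toDual ℝ (Pt d) (G t)) x := by
      simp_rw [inner_sub_right]
      exact ((InnerProductSpace.toDual ℝ (Pt d) (G t)).hasFDerivAt.sub_const _).add_const _
    refine h1.congr_of_eventuallyEq ?_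
    filter_upwards [mem_interior_iff_mem_nhds.1 hx] with y hy
    rw [hg t ht hy, ← hdiff]
    ring

theorem IsElementGradient.normalDeriv_eq {q : Pt d → ℝ} {G : Finset (Pt d) → Pt d}
    (hG : T.IsElementGradient q G) {t : Finset (Pt d)} (ht : t ∈ T.elements) {v w x : Pt d}
    (hv : v ∈ t) (hw : w ∈ t) (hx : x ∈ interior (cell t)) :
    normalDeriv q v w x = (q w - q v) / dist v w := by
  rw [normalDeriv, (hG.hasGradientAt t ht x hx).hasFDerivAt.fderiv,
    InnerProductSpace.toDual_apply_apply, normal, real_inner_smul_right,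
    hG.sub_eq t ht v (subset_cell t hv) w (subset_cell t hw), inv_mul_eq_div]

/-- The sum of the squared element gradients is controlled by the `H¹` seminorm. -/
theorem IsElementGradient.sum_le_h1Seminorm_sq (hΩ : IsPolyhedralDomain Ω) {q : Pt d → ℝ}
    {G : Finset (Pt d) → Pt d} (hG : T.IsElementGradient q G) :
    ∑ t ∈ T.elements, ‖G t‖ ^ 2 * volume.real (cell t) ≤ h1Seminorm Ω q ^ 2 := by
  have hbound : ∀ t : Finset (Pt d), volume (interior (cell t)) < ⊤ := fun t =>
    ((isCompact_cell t).isBounded.subset interior_subset).measure_lt_top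
  have hae : Ω ≤ᵐ[volume] (⋃ t ∈ T.elements, interior (cell t) : Set (Pt d)) := by
    have h3 : ∀ᵐ x : Pt d, ∀ t ∈ T.elements, x ∉ cell t \ interior (cell t) := by
      rw [Filter.eventually_all_finset]
      exact fun t _ => measure_eq_zero_iff_ae_notMem.1 (volume_cell_diff_interior t)
    filter_upwards [h3] with x hx hxΩ
    have h := subset_closure hxΩ
    rw [T.closure_eq_iUnion] at h
    obtain ⟨t, ht, hxt⟩ := Set.mem_iUnion₂.1 h
    refine Set.mem_iUnion₂.2 ⟨t, ht, ?_⟩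
    by_contra hcon
    exact hx t ht ⟨hxt, hcon⟩
  have heq : ∀ t ∈ T.elements, Set.EqOn (fun x => ‖gradient q x‖ ^ 2) (fun _ => ‖G t‖ ^ 2)
      (interior (cell t)) := fun t ht x hx => by
    simp only [(hG.hasGradientAt t ht x hx).gradient]
  have hint : ∀ t ∈ T.elements,
      IntegrableOn (fun x => ‖gradient q x‖ ^ 2) (interior (cell t)) := fun t ht =>
    (integrableOn_congr_fun (heq t ht) isOpen_interior.measurableSet).2
      (integrableOn_const (hbound t).ne)
  have hintU : IntegrableOn (fun x => ‖gradient q x‖ ^ 2)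
      (⋃ t ∈ T.elements, interior (cell t)) := integrableOn_finset_iUnion.2 hint
  -- Needed for the monotonicity below: the integral of a nonintegrable function is `0` by
  -- convention.
  have hintΩ : IntegrableOn (fun x => ‖gradient q x‖ ^ 2) Ω := hintU.mono_set_ae hae
  rw [h1Seminorm, Real.sq_sqrt (integral_nonneg fun x => by positivity)]
  calc ∑ t ∈ T.elements, ‖G t‖ ^ 2 * volume.real (cell t)
      = ∑ t ∈ T.elements, ∫ x in interior (cell t), ‖gradient q x‖ ^ 2 := by
        refine Finset.sum_congr rfl fun t ht => ?_
        rw [setIntegral_congr_fun isOpen_interior.measurableSet (heq t ht), setIntegral_const,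
          smul_eq_mul, mul_comm]
        congr 1
        refine measureReal_congr ?_
        refine Filter.EventuallyLE.antisymm ?_ (LE.le.eventuallyLE interior_subset)
        rw [ae_le_set]
        exact volume_cell_diff_interior t
    _ = ∫ x in ⋃ t ∈ T.elements, interior (cell t), ‖gradient q x‖ ^ 2 := by
        rw [integral_biUnion_finset _ (fun t _ => isOpen_interior.measurableSet)
          (fun t ht t' ht' hne => disjoint_interior_cell ht ht' hne) hint]
    _ ≤ ∫ x in Ω, ‖gradient q x‖ ^ 2 := by
        refine setIntegral_mono_set hintΩ (Filter.Eventually.of_forall fun x => by positivity) ?_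
        exact LE.le.eventuallyLE
          (Set.iUnion₂_subset fun t ht => interior_cell_subset hΩ ht)

end Triangulation

end RhieChow

end

/-! ### From estimates on single boxes to the bound for the operators. -/

noncomputable section

namespace RhieChow

namespace Triangulation

variable {d : ℕ} {Ω : Set (Pt d)} {T : Triangulation Ω}

/-! ### Estimates on a single box -/

/-- The Euclidean norm of the element gradients around the vertex `v`. -/
def patchNorm (T : Triangulation Ω) (G : Finset (Pt d) → Pt d) (v : Pt d) : ℝ :=
  Real.sqrt (∑ t ∈ T.elements.filter (fun t => v ∈ t), ‖G t‖ ^ 2)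

theorem patchNorm_nonneg (G : Finset (Pt d) → Pt d) (v : Pt d) : 0 ≤ T.patchNorm G v :=
  Real.sqrt_nonneg _

theorem sq_patchNorm (G : Finset (Pt d) → Pt d) (v : Pt d) :
    T.patchNorm G v ^ 2 = ∑ t ∈ T.elements.filter (fun t => v ∈ t), ‖G t‖ ^ 2 :=
  Real.sq_sqrt (Finset.sum_nonneg fun _ _ => by positivity)

theorem norm_le_patchNorm (G : Finset (Pt d) → Pt d) {v : Pt d} {t : Finset (Pt d)}
    (ht : t ∈ T.elements) (hv : v ∈ t) : ‖G t‖ ≤ T.patchNorm G v :=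
  Real.le_sqrt_of_sq_le (Finset.single_le_sum (f := fun t => ‖G t‖ ^ 2)
    (fun _ _ => by positivity) (Finset.mem_filter.2 ⟨ht, hv⟩))

theorem norm_normal_le_one (v w : Pt d) : ‖normal v w‖ ≤ 1 := by
  rw [normal, norm_smul, norm_inv, Real.norm_of_nonneg dist_nonneg, dist_comm, dist_eq_norm]
  exact inv_mul_le_one

theorem faceArea_nonneg (v w : Pt d) : 0 ≤ T.faceArea v w := measureReal_nonneg

theorem exists_element_of_mem_neighbours {σ : ℝ} (hT : T.IsRegular σ) {v w : Pt d}
    (hv : v ∈ T.interiorVertices) (hw : w ∈ T.neighbours v) :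
    ∃ t ∈ T.elements, v ∈ t ∧ w ∈ t := by
  obtain ⟨-, -, hpos⟩ := mem_neighbours.1 hw
  obtain ⟨x, hx⟩ : (T.face v w).Nonempty := by
    by_contra h
    rw [Set.not_nonempty_iff_eq_empty] at h
    rw [faceArea, h, measureReal_empty] at hpos
    exact lt_irrefl _ hpos
  obtain ⟨t, ht, hvt, hwt, -⟩ := hT.face_subset v hv w hw x hx
  exact ⟨t, ht, hvt, hwt⟩

theorem IsElementGradient.abs_sub_le {σ : ℝ} (hT : T.IsRegular σ) {q : Pt d → ℝ}
    {G : Finset (Pt d) → Pt d} (hG : T.IsElementGradient q G) {v w : Pt d}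
    (hv : v ∈ T.interiorVertices) (hw : w ∈ T.neighbours v) :
    |q w - q v| ≤ T.patchNorm G v * dist v w := by
  obtain ⟨t, ht, hvt, hwt⟩ := exists_element_of_mem_neighbours hT hv hw
  rw [hG.sub_eq t ht v (subset_cell t hvt) w (subset_cell t hwt), dist_comm, dist_eq_norm]
  refine (abs_real_inner_le_norm _ _).trans ?_
  gcongr
  exact norm_le_patchNorm G ht hvt

theorem boxVol_smul_gaussGreen (hd : 1 ≤ d) (hΩ : IsOpen Ω) (q : Pt d → ℝ) {v : Pt d}
    (hv : v ∈ T.interiorVertices) :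
    T.boxVol v • T.gaussGreen q v = ∑ w ∈ T.neighbours v,
      (T.faceArea v w * (T.weight v w * q v + (1 - T.weight v w) * q w)) • normal v w := by
  obtain ⟨hvV, hvΩ⟩ := mem_interiorVertices.1 hv
  by_cases h0 : T.boxVol v = 0
  -- A box of zero volume has no neighbours, so the junk value of the inverse in `gaussGreen` is
  -- harmless.
  · have h1 := sum_dist_mul_faceArea hd hΩ hvΩ hvV
    rw [h0, mul_zero, Finset.sum_eq_zero_iff_of_nonneg
      (fun w _ => mul_nonneg dist_nonneg (faceArea_nonneg v w))] at h1
    rw [h0, zero_smul, eq_comm]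
    refine Finset.sum_eq_zero fun w hw => ?_
    obtain ⟨-, hwv, hpos⟩ := mem_neighbours.1 hw
    exact absurd (h1 w hw) (mul_pos (dist_pos.2 hwv.symm) hpos).ne'
  · rw [gaussGreen, smul_inv_smul₀ h0]

/-- The difference between the integral of the gradient over a box and the corresponding
Gauss-Green approximation. -/
def gradientDefect (T : Triangulation Ω) (p : Pt d → ℝ) (v : Pt d) : Pt d :=
  (∫ y in T.box v, gradient p y) - T.boxVol v • T.gaussGreen p v

/-- The two terms are bounded separately: the integral of the gradient contributes `1`, the
Gauss–Green sum `2 d`. -/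
theorem IsElementGradient.norm_gradientDefect_le (hd : 1 ≤ d) (hΩ : IsOpen Ω) {σ : ℝ}
    (hT : T.IsRegular σ) {p : Pt d → ℝ} {G : Finset (Pt d) → Pt d}
    (hG : T.IsElementGradient p G) {v : Pt d} (hv : v ∈ T.interiorVertices) :
    ‖T.gradientDefect p v‖ ≤ (1 + 2 * d) * T.boxVol v * T.patchNorm G v := by
  obtain ⟨hvV, hvΩ⟩ := mem_interiorVertices.1 hv
  have h1 : ‖∫ y in T.box v, gradient p y‖ ≤ T.patchNorm G v * T.boxVol v := by
    refine norm_setIntegral_le_of_norm_le_const_ae (volume_box_lt_top hΩ hvΩ) ?_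
    filter_upwards [ae_box_mem_interior hd hΩ hT hv] with x ⟨t, ht, hvt, hx⟩
    rw [(hG.hasGradientAt t ht x hx).gradient]
    exact norm_le_patchNorm G ht hvt
  have h2 : T.boxVol v • T.gaussGreen p v = ∑ w ∈ T.neighbours v,
      (T.faceArea v w * ((1 - T.weight v w) * (p w - p v))) • normal v w := by
    -- Minkowski's relation replaces nodal values by differences along edges, which the element
    -- gradients control.
    have hM : ∑ w ∈ T.neighbours v, (T.faceArea v w * p v) • normal v w = 0 := by
      rw [← smul_zero (p v), ← sum_faceArea_smul_normal hd hΩ hvΩ hvV, Finset.smul_sum]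
      refine Finset.sum_congr rfl fun w _ => ?_
      rw [smul_smul, mul_comm]
    rw [boxVol_smul_gaussGreen hd hΩ p hv, ← sub_zero (∑ w ∈ T.neighbours v, _), ← hM,
      ← Finset.sum_sub_distrib]
    refine Finset.sum_congr rfl fun w _ => ?_
    rw [← sub_smul]
    congr 1
    ring
  have h3 : ‖T.boxVol v • T.gaussGreen p v‖ ≤ T.patchNorm G v * (2 * d * T.boxVol v) := by
    rw [h2, ← sum_dist_mul_faceArea hd hΩ hvΩ hvV, Finset.mul_sum]
    refine norm_sum_le_of_le _ fun w hw => ?_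
    have hw0 := weight_nonneg (T := T) v w
    have hw1 := weight_le_half hd hvV hw
    rw [norm_smul, norm_mul, norm_mul, Real.norm_of_nonneg (faceArea_nonneg v w), Real.norm_of_nonneg
      (by linarith), Real.norm_eq_abs]
    calc T.faceArea v w * ((1 - T.weight v w) * |p w - p v|) * ‖normal v w‖
        ≤ T.faceArea v w * (1 * (T.patchNorm G v * dist v w)) * 1 := by
          have := faceArea_nonneg (T := T) v w
          have := patchNorm_nonneg (T := T) G v
          have := hG.abs_sub_le hT hv hw
          have := norm_normal_le_one v w
          gcongr
          linarith
      _ = T.patchNorm G v * (dist v w * T.faceArea v w) := by ring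
  rw [gradientDefect]
  refine (norm_sub_le _ _).trans ?_
  linarith

theorem diagCoeff_nonneg {ν : ℝ} (hν : 0 ≤ ν) (v : Pt d) : 0 ≤ T.diagCoeff ν v :=
  Finset.sum_nonneg fun w _ =>
    div_nonneg (mul_nonneg hν (faceArea_nonneg v w)) dist_nonneg

/-- Neighbours share an element, so `d_ij ≤ h` and `d_ij |F_ij| ≤ h² |F_ij| / d_ij` term by term.
This is the source of the power `h²`. -/
theorem boxVol_le_diagCoeff (hd : 1 ≤ d) (hΩ : IsOpen Ω) {σ ν : ℝ} (hT : T.IsRegular σ)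
    (hν : 0 ≤ ν) {v : Pt d} (hv : v ∈ T.interiorVertices) :
    ν * (2 * d * T.boxVol v) ≤ T.diagCoeff ν v * T.meshSize ^ 2 := by
  obtain ⟨hvV, hvΩ⟩ := mem_interiorVertices.1 hv
  rw [← sum_dist_mul_faceArea hd hΩ hvΩ hvV, Finset.mul_sum, diagCoeff, Finset.sum_mul]
  refine Finset.sum_le_sum fun w hw => ?_
  obtain ⟨-, hwv, hpos⟩ := mem_neighbours.1 hw
  obtain ⟨t, ht, hvt, hwt⟩ := exists_element_of_mem_neighbours hT hv hw
  have h1 := dist_le_meshSize ht hvt hwt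
  have h0 : 0 < dist v w := dist_pos.2 hwv.symm
  have h2 : dist v w ^ 2 ≤ T.meshSize ^ 2 := by gcongr
  rw [div_mul_eq_mul_div, le_div_iff₀ h0]
  calc ν * (dist v w * T.faceArea v w) * dist v w = ν * T.faceArea v w * dist v w ^ 2 := by ring
    _ ≤ ν * T.faceArea v w * T.meshSize ^ 2 := by gcongr

theorem IsElementGradient.norm_inv_diagCoeff_smul_le (hd : 1 ≤ d) (hΩ : IsOpen Ω) {σ ν : ℝ}
    (hT : T.IsRegular σ) (hν : 0 < ν) {p : Pt d → ℝ} {G : Finset (Pt d) → Pt d}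
    (hG : T.IsElementGradient p G) {v : Pt d} (hv : v ∈ T.interiorVertices) :
    ‖(T.diagCoeff ν v)⁻¹ • T.gradientDefect p v‖ ≤
      (1 + 2 * d) / (2 * d * ν) * T.meshSize ^ 2 * T.patchNorm G v := by
  have hd0 : (0 : ℝ) < d := by exact_mod_cast hd
  have hA := patchNorm_nonneg (T := T) G v
  rcases (diagCoeff_nonneg (T := T) hν.le v).eq_or_lt with h0 | h0
  · rw [← h0, inv_zero, zero_smul, norm_zero]
    positivity
  · have h1 := hG.norm_gradientDefect_le hd hΩ hT hv
    have h2 := boxVol_le_diagCoeff hd hΩ hT hν.le hv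
    rw [norm_smul, norm_inv, Real.norm_of_nonneg h0.le, inv_mul_le_iff₀ h0]
    refine h1.trans ?_
    have h3 : T.boxVol v ≤ T.diagCoeff ν v * T.meshSize ^ 2 / (2 * d * ν) := by
      rw [le_div_iff₀ (by positivity)]
      linarith
    calc (1 + 2 * d) * T.boxVol v * T.patchNorm G v
        ≤ (1 + 2 * d) * (T.diagCoeff ν v * T.meshSize ^ 2 / (2 * d * ν)) * T.patchNorm G v := by
          gcongr
      _ = _ := by ring

/-! ### Sums over faces -/

theorem faceSum_sub (φ ψ : T.interiorVertices → T.interiorVertices → ℝ) :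
    T.faceSum φ - T.faceSum ψ = T.faceSum fun i j => φ i j - ψ i j := by
  simp only [faceSum, Finset.sum_sub_distrib, mul_sub]

theorem faceSum_mul_left (c : ℝ) (φ : T.interiorVertices → T.interiorVertices → ℝ) :
    T.faceSum (fun i j => c * φ i j) = c * T.faceSum φ := by
  simp only [faceSum, ← Finset.mul_sum]
  ring

theorem faceSum_add (φ ψ : T.interiorVertices → T.interiorVertices → ℝ) :
    T.faceSum (fun i j => φ i j + ψ i j) = T.faceSum φ + T.faceSum ψ := by
  simp only [faceSum, Finset.sum_add_distrib, mul_add]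

theorem faceSum_congr {φ ψ : T.interiorVertices → T.interiorVertices → ℝ}
    (h : ∀ i j : T.interiorVertices, (j : Pt d) ∈ T.neighbours i → φ i j = ψ i j) :
    T.faceSum φ = T.faceSum ψ := by
  unfold faceSum
  congr 1
  exact Finset.sum_congr rfl fun i _ => Finset.sum_congr rfl fun j hj =>
    h i j (Finset.mem_filter.1 hj).2

theorem faceSum_mono {φ ψ : T.interiorVertices → T.interiorVertices → ℝ}
    (h : ∀ i j : T.interiorVertices, (j : Pt d) ∈ T.neighbours i → φ i j ≤ ψ i j) :
    T.faceSum φ ≤ T.faceSum ψ := by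
  unfold faceSum
  gcongr with i _ j hj
  exact h i j (Finset.mem_filter.1 hj).2

theorem abs_faceSum_le (φ : T.interiorVertices → T.interiorVertices → ℝ) :
    |T.faceSum φ| ≤ T.faceSum fun i j => |φ i j| := by
  unfold faceSum
  rw [abs_mul, abs_of_pos (by norm_num : (0 : ℝ) < 1 / 2)]
  gcongr
  exact (Finset.abs_sum_le_sum_abs _ _).trans
    (Finset.sum_le_sum fun i _ => Finset.abs_sum_le_sum_abs _ _)

theorem mem_neighbours_comm (i j : T.interiorVertices) :
    (j : Pt d) ∈ T.neighbours i ↔ (i : Pt d) ∈ T.neighbours j := by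
  rw [mem_neighbours, mem_neighbours, faceArea_comm (j : Pt d) i, ne_comm]
  have hi := (mem_interiorVertices.1 i.2).1
  have hj := (mem_interiorVertices.1 j.2).1
  tauto

theorem faceSum_swap (φ : T.interiorVertices → T.interiorVertices → ℝ) :
    T.faceSum (fun i j => φ j i) = T.faceSum φ := by
  unfold faceSum
  congr 1
  refine Finset.sum_comm' fun i j => ?_
  simp only [Finset.mem_univ, true_and, Finset.mem_filter, and_true]
  exact mem_neighbours_comm i j

/-- The Cauchy-Schwarz inequality for sums over faces. -/
theorem faceSum_mul_le_sqrt_mul_sqrt (φ ψ : T.interiorVertices → T.interiorVertices → ℝ) :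
    T.faceSum (fun i j => φ i j * ψ i j) ≤
      Real.sqrt (T.faceSum fun i j => φ i j ^ 2) * Real.sqrt (T.faceSum fun i j => ψ i j ^ 2) := by
  unfold faceSum
  simp only [Finset.sum_sigma']
  rw [Real.sqrt_mul (by norm_num), Real.sqrt_mul (by norm_num), mul_mul_mul_comm,
    Real.mul_self_sqrt (by norm_num)]
  gcongr
  exact Real.sum_mul_le_sqrt_mul_sqrt _ _ _

/-- A sum over the interior neighbours is bounded by the sum over all neighbours. -/
theorem faceSum_dist_mul_faceArea_le (hd : 1 ≤ d) (hΩ : IsOpen Ω)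
    {c : T.interiorVertices → ℝ} (hc : ∀ i, 0 ≤ c i) :
    T.faceSum (fun i j => dist (i : Pt d) j * T.faceArea i j * c i) ≤
      d * ∑ i : T.interiorVertices, T.boxVol i * c i := by
  unfold faceSum
  rw [Finset.mul_sum, Finset.mul_sum]
  refine Finset.sum_le_sum fun i _ => ?_
  obtain ⟨hvV, hvΩ⟩ := mem_interiorVertices.1 i.2
  have h1 := sum_dist_mul_faceArea hd hΩ hvΩ hvV
  rw [← Finset.sum_mul]
  have h2 : ∑ j ∈ Finset.univ.filter (fun j : T.interiorVertices => (j : Pt d) ∈ T.neighbours i),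
      dist (i : Pt d) j * T.faceArea i j ≤
      ∑ w ∈ T.neighbours (i : Pt d), dist (i : Pt d) w * T.faceArea i w := by
    refine (Finset.sum_map (Finset.univ.filter
      (fun j : T.interiorVertices => (j : Pt d) ∈ T.neighbours i)) (Function.Embedding.subtype _)
      (fun w => dist (i : Pt d) w * T.faceArea i w)).ge.trans ?_
    refine Finset.sum_le_sum_of_subset_of_nonneg (fun w hw => ?_)
      fun w _ _ => mul_nonneg dist_nonneg (faceArea_nonneg _ _)
    obtain ⟨j, hj, rfl⟩ := Finset.mem_map.1 hw
    exact (Finset.mem_filter.1 hj).2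
  rw [h1] at h2
  have := mul_le_mul_of_nonneg_right h2 (hc i)
  linarith

/-! ### Volumes -/

/-- Boxes are at most a fixed multiple of any element in volume. -/
theorem boxVol_le_volume_cell {σ : ℝ} (hσ : 0 < σ) (hT : T.IsRegular σ) {v : Pt d}
    (hv : v ∈ T.interiorVertices) {t : Finset (Pt d)} (ht : t ∈ T.elements) :
    T.boxVol v ≤ σ * (σ ^ 2) ^ d / volume.real (Metric.ball (0 : Pt d) 1) *
      volume.real (cell t) := by
  have hω : 0 < volume.real (Metric.ball (0 : Pt d) 1) :=
    ENNReal.toReal_pos (Metric.measure_ball_pos volume _ one_pos).ne' measure_ball_lt_top.ne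
  obtain ⟨t', ht', -, -, h1⟩ := hT.boxVol_equiv v hv
  obtain ⟨c, hc⟩ := hT.shape t ht
  have h2 : (Metric.diam (cell t) / σ) ^ d * volume.real (Metric.ball (0 : Pt d) 1) ≤
      volume.real (cell t) := by
    have h := measureReal_mono hc (isCompact_cell t).measure_lt_top.ne (μ := volume)
    rwa [Measure.addHaar_real_closedBall _ _ (div_nonneg Metric.diam_nonneg hσ.le),
      finrank_euclideanSpace_fin] at h
  -- Quasi-uniformity, written in terms of the inscribed radius `h_△ / σ`.
  have h3 : Metric.diam (cell t') ≤ σ ^ 2 * (Metric.diam (cell t) / σ) := by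
    refine ((diam_cell_le_meshSize ht').trans (hT.quasiUniform t ht)).trans (le_of_eq ?_)
    field_simp
  calc T.boxVol v ≤ σ * Metric.diam (cell t') ^ d := h1
    _ ≤ σ * (σ ^ 2 * (Metric.diam (cell t) / σ)) ^ d := by
      gcongr
    _ = σ * (σ ^ 2) ^ d / volume.real (Metric.ball (0 : Pt d) 1) *
        ((Metric.diam (cell t) / σ) ^ d * volume.real (Metric.ball (0 : Pt d) 1)) := by
      rw [mul_pow]
      field_simp
    _ ≤ _ := by gcongr

/-- After exchanging the sums each element is counted once per interior vertex, so at most `d + 1`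
times. -/
theorem sum_boxVol_mul_sq_patchNorm_le {K : ℝ}
    (hK : ∀ v ∈ T.interiorVertices, ∀ t ∈ T.elements, T.boxVol v ≤ K * volume.real (cell t))
    (hK0 : 0 ≤ K) (G : Finset (Pt d) → Pt d) :
    ∑ i : T.interiorVertices, T.boxVol i * T.patchNorm G i ^ 2 ≤
      (d + 1) * K * ∑ t ∈ T.elements, ‖G t‖ ^ 2 * volume.real (cell t) := by
  rw [Finset.sum_coe_sort T.interiorVertices (fun v => T.boxVol v * T.patchNorm G v ^ 2)]
  calc ∑ v ∈ T.interiorVertices, T.boxVol v * T.patchNorm G v ^ 2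
      ≤ ∑ v ∈ T.interiorVertices, ∑ t ∈ T.elements.filter (fun t => v ∈ t),
          K * (‖G t‖ ^ 2 * volume.real (cell t)) := by
        refine Finset.sum_le_sum fun v hv => ?_
        rw [sq_patchNorm, Finset.mul_sum]
        refine Finset.sum_le_sum fun t ht => ?_
        have := mul_le_mul_of_nonneg_right (hK v hv t (Finset.mem_filter.1 ht).1)
          (sq_nonneg ‖G t‖)
        linarith
    _ = ∑ t ∈ T.elements, ∑ v ∈ T.interiorVertices.filter (fun v => v ∈ t),
          K * (‖G t‖ ^ 2 * volume.real (cell t)) :=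
        Finset.sum_comm' fun v t => by simp only [Finset.mem_filter]; tauto
    _ ≤ ∑ t ∈ T.elements, (d + 1) * K * (‖G t‖ ^ 2 * volume.real (cell t)) := by
        refine Finset.sum_le_sum fun t ht => ?_
        rw [Finset.sum_const, nsmul_eq_mul, mul_assoc]
        have h1 : (T.interiorVertices.filter (fun v => v ∈ t)).card ≤ d + 1 := by
          rw [← (mem_elements.1 ht).2]
          exact Finset.card_le_card fun v hv => (Finset.mem_filter.1 hv).2
        have h2 : ((T.interiorVertices.filter (fun v => v ∈ t)).card : ℝ) ≤ d + 1 := by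
          exact_mod_cast h1
        gcongr
    _ = _ := by rw [Finset.mul_sum]

/-! ### The operators -/

theorem sAux2_eq_sDisc2 (hd : 1 ≤ d) {σ : ℝ} (hT : T.IsRegular σ) (ν : ℝ) {q : Pt d → ℝ}
    (hq : T.IsP1 q) (z : T.BoxFun) : T.sAux2 ν q z = T.sDisc2 ν q z := by
  obtain ⟨G, hG⟩ := hq.exists_isElementGradient
  refine faceSum_congr fun i j hij => integral_congr_ae ?_
  filter_upwards [ae_face_mem_interior hd hT i.2 hij] with x ⟨t, ht, hi, hj, hx⟩
  rw [hG.normalDeriv_eq ht hi hj hx]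
  rfl

theorem starNorm_eq_sqrt (hd : 1 ≤ d) {σ : ℝ} (hT : T.IsRegular σ) {q : Pt d → ℝ} (hq : T.IsP1 q) :
    T.starNorm q = Real.sqrt (T.faceSum fun i j =>
      (Real.sqrt (T.faceArea i j / dist (i : Pt d) j) * |q j - q i|) ^ 2) := by
  obtain ⟨G, hG⟩ := hq.exists_isElementGradient
  unfold starNorm
  congr 1
  refine faceSum_congr fun i j hij => ?_
  have hpos : 0 < dist (i : Pt d) j := dist_pos.2 (mem_neighbours.1 hij).2.1.symm
  have h1 : ∫ x in T.face i j, |normalDeriv q (i : Pt d) j x| ^ 2 ∂surf =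
      ∫ x in T.face i j, |(q j - q i) / dist (i : Pt d) j| ^ 2 ∂surf := by
    refine integral_congr_ae ?_
    filter_upwards [ae_face_mem_interior hd hT i.2 hij] with x ⟨t, ht, hi, hj, hx⟩
    rw [hG.normalDeriv_eq ht hi hj hx]
  rw [h1, setIntegral_const, smul_eq_mul, mul_pow,
    Real.sq_sqrt (div_nonneg (faceArea_nonneg _ _) dist_nonneg), sq_abs, sq_abs, div_pow, faceArea]
  field_simp

/-- The second parts cancel; the integrands of the first parts are constant on each face. -/
theorem sAux_sub_sDisc (hd : 1 ≤ d) {σ : ℝ} (hT : T.IsRegular σ) (ν : ℝ) {p : Pt d → ℝ}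
    (hp : T.IsP1 p) (z : T.BoxFun) :
    T.sAux ν p z - T.sDisc ν p z = T.faceSum fun i j => T.faceArea i j *
      (inner ℝ (T.weight i j • (T.diagCoeff ν i)⁻¹ • T.gradientDefect p i
        + (1 - T.weight i j) • (T.diagCoeff ν j)⁻¹ • T.gradientDefect p j)
        (normal (i : Pt d) j) * T.jump z i j) := by
  rw [sAux, sDisc, sAux2_eq_sDisc2 hd hT ν hp, sub_sub_sub_cancel_right, sAux1, sDisc1,
    faceSum_sub]
  refine faceSum_congr fun i j _ => ?_
  rw [setIntegral_const, setIntegral_const, smul_eq_mul, smul_eq_mul, ← mul_sub, ← sub_mul,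
    ← inner_sub_left, faceArea]
  congr 4
  simp only [gradientDefect, smul_sub, smul_smul, mul_assoc]
  abel

theorem abs_sAux_sub_sDisc_le (hd : 1 ≤ d) (hΩ : IsPolyhedralDomain Ω) {σ ν K : ℝ}
    (hT : T.IsRegular σ) (hν : 0 < ν)
    (hK : ∀ v ∈ T.interiorVertices, ∀ t ∈ T.elements, T.boxVol v ≤ K * volume.real (cell t))
    (hK0 : 0 ≤ K) {p q : Pt d → ℝ} (hp : T.IsP1 p) (hq : T.IsP1 q) :
    |T.sAux ν p (T.lump q) - T.sDisc ν p (T.lump q)| ≤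
      (1 + 2 * d) / (2 * d * ν) * T.meshSize ^ 2 *
        (Real.sqrt (4 * d * (d + 1) * K) * h1Seminorm Ω p * T.starNorm q) := by
  obtain ⟨G, hG⟩ := hp.exists_isElementGradient
  set M : ℝ := (1 + 2 * d) / (2 * d * ν) * T.meshSize ^ 2 with hM
  have hM0 : 0 ≤ M := by positivity
  rw [sAux_sub_sDisc hd hT ν hp]
  refine (abs_faceSum_le _).trans ?_
  have h1 : T.faceSum (fun i j => |T.faceArea i j *
      (inner ℝ (T.weight i j • (T.diagCoeff ν i)⁻¹ • T.gradientDefect p i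
        + (1 - T.weight i j) • (T.diagCoeff ν j)⁻¹ • T.gradientDefect p j)
        (normal (i : Pt d) j) * T.jump (T.lump q) i j)|) ≤
      M * T.faceSum (fun i j =>
        (Real.sqrt (dist (i : Pt d) j * T.faceArea i j) * (T.patchNorm G i + T.patchNorm G j)) *
        (Real.sqrt (T.faceArea i j / dist (i : Pt d) j) * |q j - q i|)) := by
    rw [← faceSum_mul_left]
    refine faceSum_mono fun i j hij => ?_
    have hpos : 0 < dist (i : Pt d) j := dist_pos.2 (mem_neighbours.1 hij).2.1.symm
    have hF := faceArea_nonneg (T := T) i j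
    -- This splitting of the area makes the second Cauchy–Schwarz factor equal to `starNorm`, by
    -- `starNorm_eq_sqrt`.
    have hsq : Real.sqrt (dist (i : Pt d) j * T.faceArea i j) *
        Real.sqrt (T.faceArea i j / dist (i : Pt d) j) = T.faceArea i j := by
      rw [← Real.sqrt_mul (by positivity), ← Real.sqrt_mul_self hF]
      congr 1
      rw [Real.sqrt_mul_self hF]
      field_simp
    have hw0 := weight_nonneg (T := T) (i : Pt d) j
    have hw1 := weight_le_half hd (mem_interiorVertices.1 i.2).1 hij
    have hi := hG.norm_inv_diagCoeff_smul_le hd hΩ.isOpen hT hν i.2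
    have hj := hG.norm_inv_diagCoeff_smul_le hd hΩ.isOpen hT hν j.2
    rw [← hM] at hi hj
    have hn := norm_normal_le_one (i : Pt d) j
    have hvec : ‖T.weight i j • (T.diagCoeff ν i)⁻¹ • T.gradientDefect p i
        + (1 - T.weight i j) • (T.diagCoeff ν j)⁻¹ • T.gradientDefect p j‖ ≤
        M * (T.patchNorm G i + T.patchNorm G j) := by
      refine (norm_add_le _ _).trans ?_
      rw [norm_smul, norm_smul (1 - T.weight i j), Real.norm_of_nonneg hw0,
        Real.norm_of_nonneg (by linarith), mul_add]
      refine add_le_add ((mul_le_of_le_one_left (norm_nonneg _) (by linarith)).trans hi)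
        ((mul_le_of_le_one_left (norm_nonneg _) (by linarith)).trans hj)
    have hjump : |T.jump (T.lump q) i j| = |q j - q i| := abs_sub_comm _ _
    rw [abs_mul, abs_mul, abs_of_nonneg hF, hjump]
    have hinner := (abs_real_inner_le_norm
      (T.weight i j • (T.diagCoeff ν i)⁻¹ • T.gradientDefect p i
        + (1 - T.weight i j) • (T.diagCoeff ν j)⁻¹ • T.gradientDefect p j)
      (normal (i : Pt d) j)).trans
        ((mul_le_of_le_one_right (norm_nonneg _) hn).trans hvec)
    calc _ ≤ T.faceArea i j * (M * (T.patchNorm G i + T.patchNorm G j) * |q j - q i|) := by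
          gcongr
      _ = _ := by
          nth_rewrite 1 [← hsq]
          ring
  refine h1.trans ?_
  refine mul_le_mul_of_nonneg_left ((faceSum_mul_le_sqrt_mul_sqrt _ _).trans ?_) hM0
  rw [← starNorm_eq_sqrt hd hT hq]
  refine mul_le_mul_of_nonneg_right ?_ (Real.sqrt_nonneg _)
  have hp0 : 0 ≤ h1Seminorm Ω p := Real.sqrt_nonneg _
  rw [← Real.sqrt_sq hp0, ← Real.sqrt_mul (by positivity)]
  refine Real.sqrt_le_sqrt ?_
  have h2 : T.faceSum (fun i j => (Real.sqrt (dist (i : Pt d) j * T.faceArea i j) *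
      (T.patchNorm G i + T.patchNorm G j)) ^ 2) ≤
      T.faceSum (fun i j => dist (i : Pt d) j * T.faceArea i j * (2 * T.patchNorm G i ^ 2) +
        dist (i : Pt d) j * T.faceArea i j * (2 * T.patchNorm G j ^ 2)) := by
    refine faceSum_mono fun i j _ => ?_
    have h0 := mul_nonneg (dist_nonneg (x := (i : Pt d)) (y := j)) (faceArea_nonneg (T := T) i j)
    rw [mul_pow, Real.sq_sqrt h0, ← mul_add]
    refine mul_le_mul_of_nonneg_left ?_ h0
    linarith [sq_nonneg (T.patchNorm G i - T.patchNorm G j)]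
  have h3 : T.faceSum (fun i j => dist (i : Pt d) j * T.faceArea i j * (2 * T.patchNorm G j ^ 2))
      = T.faceSum (fun i j => dist (i : Pt d) j * T.faceArea i j * (2 * T.patchNorm G i ^ 2)) := by
    rw [← faceSum_swap]
    refine faceSum_congr fun i j _ => ?_
    rw [dist_comm, faceArea_comm]
  rw [faceSum_add, h3] at h2
  have h4 := faceSum_dist_mul_faceArea_le (T := T) hd hΩ.isOpen
    (c := fun i => 2 * T.patchNorm G i ^ 2) (fun i => by positivity)
  have h5 : ∑ i : T.interiorVertices, T.boxVol i * (2 * T.patchNorm G i ^ 2) =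
      2 * ∑ i : T.interiorVertices, T.boxVol i * T.patchNorm G i ^ 2 := by
    rw [Finset.mul_sum]
    exact Finset.sum_congr rfl fun i _ => by ring
  rw [h5] at h4
  have h6 := sum_boxVol_mul_sq_patchNorm_le hK hK0 G
  have h7 := hG.sum_le_h1Seminorm_sq hΩ
  -- A factor `2` from `(a + b)² ≤ 2 a² + 2 b²`, a factor `2` from the two ends of each face, and
  -- `d` from the sum of `d_ij |F_ij|` with each face counted by half.
  calc _ ≤ 4 * d * ∑ i : T.interiorVertices, T.boxVol i * T.patchNorm G i ^ 2 := by linarith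
    _ ≤ 4 * d * ((d + 1) * K * ∑ t ∈ T.elements, ‖G t‖ ^ 2 * volume.real (cell t)) := by gcongr
    _ ≤ 4 * d * ((d + 1) * K * h1Seminorm Ω p ^ 2) := by gcongr
    _ = _ := by ring

end Triangulation

end RhieChow

end

/-! ### The mesh-independent constant. -/

theorem mainTheorem8 {d : ℕ} (hd : d = 2 ∨ d = 3) (Ω : Set (RhieChow.Pt d))
    (hΩ : RhieChow.IsPolyhedralDomain Ω) (ν : ℝ) (hν : 0 < ν) (σ : ℝ) (hσ : 0 < σ) :
    ∃ C : ℝ, 0 < C ∧ ∀ T : RhieChow.Triangulation Ω, T.IsRegular σ →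
      ∀ p q : RhieChow.Pt d → ℝ, T.IsP1 p → T.IsP1 q →
        |T.sAux ν p (T.lump q) - T.sDisc ν p (T.lump q)| ≤
          C * T.meshSize ^ (3 / 2 : ℝ) * RhieChow.h1Seminorm Ω p * T.starNorm q := by
  have hd1 : 1 ≤ d := by omega
  set K : ℝ := σ * (σ ^ 2) ^ d / volume.real (Metric.ball (0 : RhieChow.Pt d) 1) with hK
  have hK0 : 0 ≤ K := by positivity
  set D : ℝ := Metric.diam (closure Ω)
  have hC : 0 ≤ (1 + 2 * d) / (2 * d * ν) * Real.sqrt D * Real.sqrt (4 * d * (d + 1) * K) := by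
    positivity
  -- `√D` absorbs the surplus `h^{1/2}`, as `h ≤ D`; the `+ 1` only secures strict positivity.
  refine ⟨(1 + 2 * d) / (2 * d * ν) * Real.sqrt D * Real.sqrt (4 * d * (d + 1) * K) + 1,
    by linarith, fun T hT p q hp hq => ?_⟩
  have hmain := RhieChow.Triangulation.abs_sAux_sub_sDisc_le hd1 hΩ hT hν
    (fun v hv t ht => RhieChow.Triangulation.boxVol_le_volume_cell hσ hT hv ht) hK0 hp hq
  have hh : 0 ≤ T.meshSize := RhieChow.Triangulation.meshSize_nonneg
  have hhD : Real.sqrt T.meshSize ≤ Real.sqrt D :=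
    Real.sqrt_le_sqrt (RhieChow.Triangulation.meshSize_le_diam hΩ)
  have hp0 : 0 ≤ RhieChow.h1Seminorm Ω p := Real.sqrt_nonneg _
  have hq0 : 0 ≤ T.starNorm q := Real.sqrt_nonneg _
  have hpow : T.meshSize ^ 2 = T.meshSize ^ (3 / 2 : ℝ) * Real.sqrt T.meshSize := by
    rw [Real.sqrt_eq_rpow, ← Real.rpow_add_of_nonneg hh (by norm_num) (by norm_num),
      ← Real.rpow_natCast]
    norm_num
  calc _ ≤ _ := hmain
    _ = (1 + 2 * d) / (2 * d * ν) * Real.sqrt T.meshSize * Real.sqrt (4 * d * (d + 1) * K) *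
        T.meshSize ^ (3 / 2 : ℝ) * RhieChow.h1Seminorm Ω p * T.starNorm q := by
      rw [hpow]; ring
    _ ≤ ((1 + 2 * d) / (2 * d * ν) * Real.sqrt D * Real.sqrt (4 * d * (d + 1) * K) + 1) *
        T.meshSize ^ (3 / 2 : ℝ) * RhieChow.h1Seminorm Ω p * T.starNorm q := by
      gcongr
      refine le_trans ?_ (le_add_of_nonneg_right zero_le_one)
      gcongr
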